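/- Let $X$ be a complete Hausdorff locally convex space over $\mathbb T\in\{\mathbb R,\mathbb C\}$ whose topology is generated by seminorms $\|\cdot\|_\alpha$, $\alpha\in\Omega$, and let $\mathcal L(X)$ be the space of continuous linear operators on $X$ with the topology of pointwise convergence. A family $B\subset\mathcal L(X)$ is equicontinuous if for every $\alpha$ there are finitely many $\alpha_i\in\Omega$ and $b_i>0$ with $\sup_{G\in B}\|Gx\|_\alpha\le\sum_i b_i\|x\|_{\alpha_i}$ for all $x\in X$. Let $\mathcal E_X$ be the set of all $F:[0,\infty)\to\mathcal L(X)$ such that $F(0)=I$ and, for every $s\ge 0$, the family $\{F(d/n)^m : m,n\in\mathbb N,\ d\ge 0,\ md/n\le s\}$ is equicontinuous. For $F:[0,\infty)\to\mathcal L(X)$ and $f\in X$, let $F'_{mef}(0)f$ be the set of all $g\in X$ for which there are $f_h\in X$ with $f_h\to f$ and $h^{-1}(F(h)-F(0))f_h\to g$ as $h\to 0+$; its domain consists of the $f$ for which this set is non-empty. Let $\mathcal F_X$ be the set of all $F\in\mathcal E_X$ for which this domain is dense in $X$; for such $F$ the set $F'_{mef}(0)f$ has at most one element, and the effective derivative $F'_{ef}(0)$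 sends each $f$ in the domain to that element. An $lC_0$-semigroup is a continuous $T\in\mathcal E_X$ with $T(l+m)=T(l)T(m)$ for all $l,m\ge 0$; its generator is the operator $x\mapsto\lim_{h\to0+}h^{-1}(T(h)x-x)$, defined wherever the limit exists. **Theorem 8.3.** Let $Z$ be a densely defined linear operator in $X$ and let $t>0$. Assume that $F\in\mathcal F_X$ satisfies $\mathcal D(Z)\subset\mathcal D(F'_{ef}(0))$ and $F'_{ef}(0)g=Zg$ for all $g\in\mathcal D(Z)$. Then $Z$ is closable and its closure $\overline Z$ is the generator of an $lC_0$-semigroup if and only if there is a dense linear subspace $A\subset\mathcal D(Z)$ such that for all $f\in A$ and $s\ge 0$ there is a sequence $f^s_n\in\mathcal D(\overline Z)$, $n\ge 1$, with the following properties: (a) $F(t/n)^{[ns]}f-f^s_n\to 0$ weakly as $n\to\infty$; (b) every subsequence of $\{F(t/n)^{[ns/t]}f\}_{n\in\mathbb N}$ has a convergent sub-subsequence; (c) every subsequence of $\{\overline Z f^s_n\}_{n\in\mathbb N}$ has a weakly convergent sub-subsequence. (Here $[\cdot]$ is the integer part. Under the stated assumptions $Z$ is always closable, so $\overline Z$ makes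 sense in (a)-(c).) -/

import Mathlib

open Filter Topology
open scoped NNReal

namespace LocallyConvexChernoff

variable {𝕜 X ι : Type*} [RCLike 𝕜] [AddCommGroup X] [Module 𝕜 X]

/-- A family `B` of continuous linear operators is equicontinuous with respect to the defining
family of seminorms `p`: for every `α` there are finitely many `α₁, …, αₙ` and constants
`bᵢ > 0` such that `sup_{G ∈ B} ‖G x‖_α ≤ ∑ bᵢ ‖x‖_{αᵢ}` for all `x`. -/
def EquicontinuousFamily [TopologicalSpace X] (p : SeminormFamily 𝕜 X ι)
    (B : Set (X →L[𝕜] X)) : Prop :=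
  ∀ α : ι, ∃ (J : Finset ι) (b : ι → ℝ), (∀ i ∈ J, 0 < b i) ∧
    ∀ G ∈ B, ∀ x : X, p α (G x) ≤ ∑ i ∈ J, b i * p i x

/-- The family `{F(d/n)^m : m d / n ≤ s, n, m ∈ {1, 2, …}, d ≥ 0}`. -/
def iterates [TopologicalSpace X] (F : ℝ≥0 → X →L[𝕜] X) (s : ℝ≥0) : Set (X →L[𝕜] X) :=
  {G | ∃ (d : ℝ≥0) (n m : ℕ), 1 ≤ n ∧ 1 ≤ m ∧ (m : ℝ≥0) * d / (n : ℝ≥0) ≤ s ∧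
    G = F (d / (n : ℝ≥0)) ^ m}

/-- The class `𝓔_X`: `F(0) = I`, and `iterates F s` is equicontinuous for every `s ≥ 0`. -/
def ClassE [TopologicalSpace X] (p : SeminormFamily 𝕜 X ι) (F : ℝ≥0 → X →L[𝕜] X) : Prop :=
  F 0 = ContinuousLinearMap.id 𝕜 X ∧ ∀ s : ℝ≥0, EquicontinuousFamily p (iterates F s)

/-- The many-valued effective derivative `F'_mef(0)`: `g ∈ F'_mef(0) f` iff there are `u_h` with
`u_h → f` and `h⁻¹ (F(h) - F(0)) u_h → g` as `h → 0+`. -/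
def multiEffDeriv [TopologicalSpace X] (F : ℝ≥0 → X →L[𝕜] X) (f : X) : Set X :=
  {g | ∃ u : ℝ≥0 → X, Tendsto u (𝓝[>] 0) (𝓝 f) ∧
    Tendsto (fun h : ℝ≥0 => (((h : ℝ) : 𝕜)⁻¹) • (F h (u h) - F 0 (u h))) (𝓝[>] 0) (𝓝 g)}

/-- The class `𝓕_X`: the members of `𝓔_X` for which the domain of `F'_mef(0)` is dense. -/
def ClassF [TopologicalSpace X] (p : SeminormFamily 𝕜 X ι) (F : ℝ≥0 → X →L[𝕜] X) : Prop :=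
  ClassE p F ∧ Dense {f : X | (multiEffDeriv F f).Nonempty}

/-- `lC₀`-semigroups: the semigroup law, continuity for the topology of pointwise convergence on
the space of operators, and membership in `𝓔_X`. -/
structure IsLC0Semigroup [TopologicalSpace X] (p : SeminormFamily 𝕜 X ι)
    (T : ℝ≥0 → X →L[𝕜] X) : Prop where
  map_zero : T 0 = ContinuousLinearMap.id 𝕜 X
  map_add : ∀ l m : ℝ≥0, T (l + m) = (T l).comp (T m)
  continuous : ∀ x : X, Continuous fun s : ℝ≥0 => T s x
  classE : ClassE p T

/-- `A` is the strong derivative at `0` of `T`, with its maximal domain: `x ∈ D(A)` and `A x = y`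
iff `h⁻¹ (T(h) x - T(0) x) → y` as `h → 0+`. For an `lC₀`-semigroup `T` this says that `A` is the
generator of `T`. -/
def IsDerivAtZero [TopologicalSpace X] (T : ℝ≥0 → X →L[𝕜] X) (A : X →ₗ.[𝕜] X) : Prop :=
  ∀ x y : X, (x, y) ∈ A.graph ↔
    Tendsto (fun h : ℝ≥0 => (((h : ℝ) : 𝕜)⁻¹) • (T h x - T 0 x)) (𝓝[>] 0) (𝓝 y)

/-- `A` is the generator of some `lC₀`-semigroup. -/
def GeneratesLC0Semigroup [TopologicalSpace X] (p : SeminormFamily 𝕜 X ι)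
    (A : X →ₗ.[𝕜] X) : Prop :=
  ∃ T : ℝ≥0 → X →L[𝕜] X, IsLC0Semigroup p T ∧ IsDerivAtZero T A

/-- Every subsequence of `u` has a convergent sub-subsequence (with a limit in the space). -/
def SubseqRelCompact {Y : Type*} [TopologicalSpace Y] (u : ℕ → Y) : Prop :=
  ∀ a : ℕ → ℕ, StrictMono a →
    ∃ b : ℕ → ℕ, StrictMono b ∧ ∃ y : Y, Tendsto (fun k => u (a (b k))) atTop (𝓝 y)

end LocallyConvexChernoff

/-!
Neither resolvents nor integrals are available in this setting, so the theorem is reduced to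
estimates for the powers of `G n = F (t / n)` with step size `h n = t / n`. What is used of `F` is
collected in `IsStableScheme`: equicontinuity of the powers over finite times, and a dense domain of
the approximate derivative `limGraph G h`, which extends `Z`. From `G u = u + h B` and telescoping
one finds that a pair `(g, z)` in the *closure* of `limGraph G h` has difference quotients
`r⁻¹ (G n ^ k n g - g)`, `k n * h n → r`, that are close to `z` for small `r`
(`eventually_quotient_sub_lt`). In particular this closure is single-valued, so `Z` is closable.

The main estimate is `eventually_polygon_lt`. Let `y 0, …, y M` be points with derivatives
`z 0, …, z M` in the closure of `limGraph G h`, such that the slope of each edge, for the time step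
`δ`, is `η`-close to the derivatives at both of its ends. Then the scheme started at `y 0` arrives
at `y M`, up to an error `M δ η`. It is used in both directions.

* If `Z.closure` generates `T`, the points `T (i δ) f`, `f ∈ Z.domain`, are such a polygon, and
  `δ → 0` gives Chernoff's theorem on `Z.domain` (`IsLC0Semigroup.tendsto_pow`). The sequence
  `u n` may then be taken to be constant, equal to `T (s t) f`.
* Conversely, let `f ∈ A`. By the compactness conditions and the weak closedness of the graph of
  `Z.closure`, the scheme started at `f` has, along a common subsequence, limit points `y i` in the domain of
  `Z.closure` at the times `i δ`, `i ≤ M`. Their derivatives are the limits of the scheme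
  started at `Z f` (`tendsto_pow_derivative`), so the `y i` are the vertices of a polygon as above,
  which the *whole* sequence follows (`eventually_pow_sub_limit_lt`). Hence the sequence is Cauchy
  at every time, for `f ∈ A` and, by equicontinuity, for all `f ∈ X`; the limit is an
  `lC₀`-semigroup `T` whose generator extends `Z.closure` and for which `T s` maps `A` into the
  domain of `Z.closure`. Riemann sums of orbits that start in the dense set `A` show that the
  generator is no larger than `Z.closure` (`mem_closure_of_tendsto_quotient`).
-/

open Filter Topology
open scoped NNReal
namespace LocallyConvexChernoff

variable {𝕜 X ι : Type*} [RCLike 𝕜] [AddCommGroup X] [Module 𝕜 X]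

/-! ### Continuous seminorms -/

lemma seminorm_ofReal_smul (P : Seminorm 𝕜 X) {r : ℝ} (hr : 0 ≤ r) (x : X) :
    P ((r : 𝕜) • x) = r * P x := by
  rw [map_smul_eq_mul, RCLike.norm_ofReal, abs_of_nonneg hr]

lemma eventually_seminorm_sub_lt [TopologicalSpace X] [IsTopologicalAddGroup X]
    {P : Seminorm 𝕜 X} (hP : Continuous P) {β : Type*} {l : Filter β} {u : β → X} {x : X}
    (hu : Tendsto u l (𝓝 x)) {ε : ℝ} (hε : 0 < ε) : ∀ᶠ n in l, P (u n - x) < ε := by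
  have h1 : Tendsto (fun n => P (u n - x)) l (𝓝 (P (x - x))) :=
    (hP.tendsto _).comp (hu.sub_const x)
  rw [sub_self, map_zero] at h1
  exact h1.eventually_lt_const hε

lemma tendsto_of_forall_seminorm [TopologicalSpace X] {p : SeminormFamily 𝕜 X ι}
    (hp : WithSeminorms p) {β : Type*} {l : Filter β} {u : β → X} {x : X}
    (h : ∀ P : Seminorm 𝕜 X, Continuous P → ∀ ε > 0, ∀ᶠ n in l, P (u n - x) < ε) :
    Tendsto u l (𝓝 x) :=
  (hp.tendsto_nhds u x).2 fun i ε hε => h (p i) (hp.continuous_seminorm i) ε hε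

lemma exists_mem_seminorm_sub_lt [TopologicalSpace X] [IsTopologicalAddGroup X] {s : Set X}
    (hs : Dense s) {P : Seminorm 𝕜 X} (hP : Continuous P) (x : X) {ε : ℝ} (hε : 0 < ε) :
    ∃ g ∈ s, P (x - g) < ε := by
  obtain ⟨g, hg, hgs⟩ := hs.exists_mem_open
    (isOpen_lt (hP.comp (continuous_const.sub continuous_id)) continuous_const :
      IsOpen {g | P (x - g) < ε}) ⟨x, by simpa using hε⟩
  exact ⟨g, hg, hgs⟩

lemma exists_mem_of_mem_closure [TopologicalSpace X] [IsTopologicalAddGroup X] {s : Set (X × X)}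
    {g z : X} (hs : (g, z) ∈ closure s) {P : Seminorm 𝕜 X} (hP : Continuous P) {ε : ℝ}
    (hε : 0 < ε) : ∃ g' z', (g', z') ∈ s ∧ P (g - g') < ε ∧ P (z - z') < ε := by
  have ho : IsOpen {q : X × X | P (g - q.1) < ε ∧ P (z - q.2) < ε} :=
    (isOpen_lt (hP.comp (continuous_const.sub continuous_fst)) continuous_const).inter
      (isOpen_lt (hP.comp (continuous_const.sub continuous_snd)) continuous_const)
  obtain ⟨q, hq, hqs⟩ := mem_closure_iff.1 hs _ ho ⟨by simpa using hε, by simpa using hε⟩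
  exact ⟨q.1, q.2, hqs, hq.1, hq.2⟩

lemma mem_closure_of_forall_seminorm [TopologicalSpace X] {p : SeminormFamily 𝕜 X ι}
    (hp : WithSeminorms p) {s : Set (X × X)} {g z : X}
    (h : ∀ P : Seminorm 𝕜 X, Continuous P → ∀ ε > 0,
      ∃ g' z', (g', z') ∈ s ∧ P (g' - g) < ε ∧ P (z' - z) < ε) : (g, z) ∈ closure s := by
  classical
  have := hp.topologicalAddGroup
  refine mem_closure_iff_nhds.2 fun U hU => ?_
  obtain ⟨V, hV, W, hW, hVW⟩ := mem_nhds_prod_iff.1 hU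
  obtain ⟨J, r, hr, hJ⟩ := (hp.mem_nhds_iff _ _).1 hV
  obtain ⟨K, r', hr', hK⟩ := (hp.mem_nhds_iff _ _).1 hW
  have hc : Continuous ((J ∪ K).sup p : Seminorm 𝕜 X) :=
    Seminorm.continuous_finsetSup fun i _ => hp.continuous_seminorm i
  obtain ⟨g', z', hs, h1, h2⟩ := h _ hc (min r r') (lt_min hr hr')
  refine ⟨(g', z'), hVW ⟨hJ ?_, hK ?_⟩, hs⟩
  · rw [Seminorm.mem_ball]
    exact ((Finset.sup_mono Finset.subset_union_left : J.sup p ≤ _) _).trans_lt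
      (h1.trans_le (min_le_left _ _))
  · rw [Seminorm.mem_ball]
    exact ((Finset.sup_mono Finset.subset_union_right : K.sup p ≤ _) _).trans_lt
      (h2.trans_le (min_le_right _ _))

lemma eq_of_forall_seminorm [TopologicalSpace X] [T2Space X] {p : SeminormFamily 𝕜 X ι}
    (hp : WithSeminorms p) {x y : X}
    (h : ∀ P : Seminorm 𝕜 X, Continuous P → ∀ ε > 0, P (x - y) < ε) : x = y := by
  have h1 : Tendsto (fun _ : ℕ => x) atTop (𝓝 y) :=
    tendsto_of_forall_seminorm hp fun P hP ε hε => Eventually.of_forall fun _ => h P hP ε hε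
  exact tendsto_nhds_unique tendsto_const_nhds h1

/-! ### Telescoping estimates -/

section Telescoping

variable [TopologicalSpace X]

lemma pow_add_apply (G : X →L[𝕜] X) (a b : ℕ) (x : X) :
    (G ^ (a + b)) x = (G ^ a) ((G ^ b) x) := by
  rw [pow_add]; rfl

/-- If `G u = u + η B`, then `G ^ m u - u = η ∑_{j < m} G ^ j B`, compared here with `m η z`. -/
lemma seminorm_pow_sub_le (G : X →L[𝕜] X) (P : Seminorm 𝕜 X) {η c : ℝ} (hη : 0 ≤ η) {u B z : X}
    (hG : G u = u + (η : 𝕜) • B) (m : ℕ) (hc : ∀ j < m, P ((G ^ j) B - z) ≤ c) :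
    P ((G ^ m) u - u - ((m * η : ℝ) : 𝕜) • z) ≤ m * η * c := by
  induction m with
  | zero => simp
  | succ m ih =>
    have e : (G ^ (m + 1)) u - u - (((m + 1 : ℕ) * η : ℝ) : 𝕜) • z
        = ((G ^ m) u - u - ((m * η : ℝ) : 𝕜) • z) + (η : 𝕜) • ((G ^ m) B - z) := by
      rw [pow_add_apply, pow_one, hG, map_add, map_smul]
      push_cast
      module
    rw [e]
    refine (map_add_le_add P _ _).trans ?_
    rw [seminorm_ofReal_smul P hη]
    have h1 := ih fun j hj => hc j (hj.trans (Nat.lt_succ_self m))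
    have h2 := mul_le_mul_of_nonneg_left (hc m (Nat.lt_succ_self m)) hη
    rw [Nat.cast_succ]
    linarith

/-- Comparison of the iterates of `G` started at `a₀` with the points of the segment from `a₀` to
`a₁`, run through at the constant speed `c` in `m` steps of length `η`. -/
lemma seminorm_pow_sub_segment_le (G : X →L[𝕜] X) (P Q : Seminorm 𝕜 X) {η M : ℝ} (hη : 0 ≤ η)
    {a₀ a₁ B₀ B₁ c : X} (h₀ : G a₀ = a₀ + (η : 𝕜) • B₀) (h₁ : G a₁ = a₁ + (η : 𝕜) • B₁)
    {m : ℕ} (hm : 0 < m) (hc : a₁ - a₀ = ((m * η : ℝ) : 𝕜) • c)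
    (hPQ : ∀ j < m, ∀ x, P ((G ^ j) x) ≤ Q x) (hM₀ : Q (B₀ - c) ≤ M) (hM₁ : Q (B₁ - c) ≤ M) :
    P ((G ^ m) a₀ - a₁) ≤ m * η * M := by
  set w : ℕ → X := fun k => ((1 - k / m : ℝ) : 𝕜) • a₀ + ((k / m : ℝ) : 𝕜) • a₁ with hw
  have hmR : (0 : ℝ) < m := by exact_mod_cast hm
  have hm0 : (m : 𝕜) ≠ 0 := by exact_mod_cast hm.ne'
  have step : ∀ k, G (w k) - w (k + 1) =
      (η : 𝕜) • (((1 - k / m : ℝ) : 𝕜) • (B₀ - c) + ((k / m : ℝ) : 𝕜) • (B₁ - c)) := by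
    intro k
    have e : a₁ = a₀ + ((m * η : ℝ) : 𝕜) • c := by rw [← hc]; abel
    simp only [hw, map_add, map_smul, h₀, h₁]
    rw [e]
    push_cast
    match_scalars <;> field_simp <;> ring
  have key : ∀ k ≤ m, P ((G ^ m) a₀ - (G ^ (m - k)) (w k)) ≤ k * η * M := by
    intro k
    induction k with
    | zero => intro _; simp [hw]
    | succ k ih =>
      intro hk
      have e : (G ^ m) a₀ - (G ^ (m - (k + 1))) (w (k + 1)) =
          ((G ^ m) a₀ - (G ^ (m - k)) (w k))
            + (G ^ (m - (k + 1))) (G (w k) - w (k + 1)) := by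
        have : m - k = (m - (k + 1)) + 1 := by omega
        rw [this, pow_add_apply, pow_one, map_sub]; abel
      rw [e]
      refine (map_add_le_add P _ _).trans ?_
      have h2 : P ((G ^ (m - (k + 1))) (G (w k) - w (k + 1))) ≤ η * M := by
        refine (hPQ _ (by omega) _).trans ?_
        rw [step, seminorm_ofReal_smul Q hη]
        refine mul_le_mul_of_nonneg_left ((map_add_le_add Q _ _).trans ?_) hη
        have hθ : (k / m : ℝ) ≤ 1 := by
          rw [div_le_one hmR]; exact_mod_cast (by omega : k ≤ m)
        have hθ' : (0 : ℝ) ≤ k / m := by positivity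
        rw [seminorm_ofReal_smul Q (by linarith), seminorm_ofReal_smul Q hθ']
        nlinarith
      have := ih (by omega)
      rw [Nat.cast_succ]
      linarith
  have hwm : w m = a₁ := by simp [hw, div_self hm0]
  have := key m le_rfl
  rwa [hwm, Nat.sub_self] at this

end Telescoping

/-! ### Discrete approximations of an evolution -/

/-- The approximate derivative of the operators `G n` at the step sizes `h n`, as a relation: the
pairs `(g, z)` for which there are `u n → g` with `(h n)⁻¹ (G n (u n) - u n) → z`. The difference
quotient is named `B n` and the division by `h n` is avoided. -/
def limGraph [TopologicalSpace X] (G : ℕ → X →L[𝕜] X) (h : ℕ → ℝ) : Set (X × X) :=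
  {q | ∃ u B : ℕ → X, Tendsto u atTop (𝓝 q.1) ∧ Tendsto B atTop (𝓝 q.2) ∧
    ∀ᶠ n in atTop, G n (u n) = u n + (h n : 𝕜) • B n}

/-- Operators `G n` that advance the time by `h n → 0+`, whose powers are equicontinuous up to any
finite time `S`, and whose approximate derivative is densely defined. Equicontinuity is expressed
by continuous seminorms, and is required only for large `n`, but uniformly in the number of
steps. -/
structure IsStableScheme [TopologicalSpace X] (G : ℕ → X →L[𝕜] X) (h : ℕ → ℝ) : Prop where
  pos : ∀ᶠ n in atTop, 0 < h n
  tendsto_zero : Tendsto h atTop (𝓝 0)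
  equi : ∀ P : Seminorm 𝕜 X, Continuous P → ∀ S : ℝ, ∃ Q : Seminorm 𝕜 X, Continuous Q ∧ P ≤ Q ∧
    ∀ᶠ n in atTop, ∀ m : ℕ, m * h n ≤ S → ∀ x, P ((G n ^ m) x) ≤ Q x
  dense : Dense {g | ∃ z, (g, z) ∈ limGraph G h}

namespace IsStableScheme

variable [TopologicalSpace X] {G : ℕ → X →L[𝕜] X} {h : ℕ → ℝ}

lemma tendsto_floor_mul (H : IsStableScheme G h) {r : ℝ} (hr : 0 ≤ r) :
    Tendsto (fun n => (⌊r / h n⌋₊ : ℝ) * h n) atTop (𝓝 r) := by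
  have h1 : Tendsto (fun n => r - h n) atTop (𝓝 r) := by
    simpa using H.tendsto_zero.const_sub r
  refine tendsto_of_tendsto_of_tendsto_of_le_of_le' h1 tendsto_const_nhds ?_ ?_
  · filter_upwards [H.pos] with n hn
    have := Nat.lt_floor_add_one (r / h n)
    rw [div_lt_iff₀ hn] at this
    linarith
  · filter_upwards [H.pos] with n hn
    have := Nat.floor_le (div_nonneg hr hn.le)
    rwa [le_div_iff₀ hn] at this

variable [IsTopologicalAddGroup X]

/-- The powers of `G n` are close to the identity over short times. -/
lemma eventually_pow_sub_lt (H : IsStableScheme G h) (x : X) {P : Seminorm 𝕜 X}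
    (hP : Continuous P) {ε : ℝ} (hε : 0 < ε) :
    ∃ δ > 0, ∀ᶠ n in atTop, ∀ m : ℕ, m * h n ≤ δ → P ((G n ^ m) x - x) < ε := by
  obtain ⟨Q, hQ, hPQ, hE⟩ := H.equi P hP 1
  obtain ⟨g, ⟨z, u, B, hu, hB, hG⟩, hxg⟩ :=
    exists_mem_seminorm_sub_lt H.dense hQ x (show 0 < ε / 8 by linarith)
  have hK : 0 < Q z + 1 := by linarith [apply_nonneg Q z]
  refine ⟨min 1 (ε / (4 * (Q z + 1))), by positivity, ?_⟩
  filter_upwards [hE, hG, H.pos, eventually_seminorm_sub_lt hQ hu (show 0 < ε / 8 by linarith),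
    eventually_seminorm_sub_lt hQ hB one_pos] with n hE hG hn hun hBn m hm
  have hm1 : m * h n ≤ 1 := hm.trans (min_le_left _ _)
  have hm2 : m * h n * (Q z + 1) ≤ ε / 4 := by
    have := mul_le_mul_of_nonneg_right (hm.trans (min_le_right _ _)) hK.le
    refine this.trans (le_of_eq ?_)
    field_simp
  have hBK : Q (B n) ≤ Q z + 1 := by
    have := map_add_le_add Q (B n - z) z
    rw [sub_add_cancel] at this
    linarith
  have h1 : P ((G n ^ m) (u n) - u n) ≤ ε / 4 := by
    have := seminorm_pow_sub_le (G n) P hn.le hG m (z := 0) (c := Q z + 1) fun j hj => by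
      rw [sub_zero]
      refine (hE j ?_ _).trans hBK
      refine le_trans ?_ hm1
      gcongr
    rw [smul_zero, sub_zero] at this
    exact this.trans hm2
  have hxu : Q (x - u n) < ε / 4 := by
    have := map_sub_le_add Q (x - g) (u n - g)
    rw [sub_sub_sub_cancel_right] at this
    linarith
  have e : (G n ^ m) x - x
      = (G n ^ m) (x - u n) + ((G n ^ m) (u n) - u n) - (x - u n) := by
    rw [map_sub]; abel
  rw [e]
  have h2 := map_sub_le_add P ((G n ^ m) (x - u n) + ((G n ^ m) (u n) - u n)) (x - u n)
  have h3 := map_add_le_add P ((G n ^ m) (x - u n)) ((G n ^ m) (u n) - u n)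
  have h4 := hE m hm1 (x - u n)
  have h5 : P (x - u n) ≤ Q (x - u n) := hPQ _
  linarith

/-- A pair in the closure of the approximate derivative is a derivative at time `0` of the limiting
evolution: the difference quotients over a fixed short time `r` are close to `z`. -/
lemma eventually_quotient_sub_lt (H : IsStableScheme G h) {g z : X}
    (hgz : (g, z) ∈ closure (limGraph G h)) {P : Seminorm 𝕜 X} (hP : Continuous P) {ε : ℝ}
    (hε : 0 < ε) :
    ∃ δ > 0, ∀ r, 0 < r → r ≤ δ → ∀ k : ℕ → ℕ, Tendsto (fun n => k n * h n) atTop (𝓝 r) →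
      ∀ᶠ n in atTop, P (((r : 𝕜)⁻¹) • ((G n ^ k n) g - g) - z) < ε := by
  obtain ⟨Q, hQ, hPQ, hE⟩ := H.equi P hP 1
  obtain ⟨δ, hδ, hδE⟩ := H.eventually_pow_sub_lt z hP (show 0 < ε / 16 by linarith)
  refine ⟨min (δ / 2) (1 / 2), by positivity, fun r hr hrδ k hk => ?_⟩
  have hrδ' : r < δ := by linarith [hrδ.trans (min_le_left _ _)]
  have hr1 : r < 1 := by linarith [hrδ.trans (min_le_right _ _)]
  set ρ := min (ε / 16) (r * ε / 16) with hρ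
  have hρ0 : 0 < ρ := by positivity
  have hρ1 : ρ ≤ ε / 16 := min_le_left _ _
  have hρ2 : ρ ≤ r * ε / 16 := min_le_right _ _
  obtain ⟨g', z', ⟨u, B, hu, hB, hG⟩, hg', hz'⟩ := exists_mem_of_mem_closure hgz hQ hρ0
  have hkz : Tendsto (fun n => (k n * h n - r) * P z) atTop (𝓝 0) := by
    simpa using (hk.sub_const r).mul_const (P z)
  have hkz' : ∀ᶠ n in atTop, |(k n * h n - r) * P z| < r * ε / 16 := by
    have := hkz.abs
    rw [abs_zero] at this
    exact this.eventually_lt_const (by positivity)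
  filter_upwards [hE, hG, H.pos, eventually_seminorm_sub_lt hQ hu hρ0,
    eventually_seminorm_sub_lt hQ hB hρ0, hδE, hkz', hk.eventually_lt_const hrδ',
    hk.eventually_lt_const hr1, hk.eventually_lt_const (show r < 2 * r by linarith)]
    with n hE hG hn hun hBn hδn hkz hk1 hk2 hk3
  have hzB : Q (z - B n) ≤ ε / 8 := by
    have := map_sub_le_add Q (z - z') (B n - z')
    rw [sub_sub_sub_cancel_right] at this
    linarith
  have hgu : Q (g - u n) ≤ r * ε / 8 := by
    have := map_sub_le_add Q (g - g') (u n - g')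
    rw [sub_sub_sub_cancel_right] at this
    linarith
  have h1 : P ((G n ^ k n) (u n) - u n - ((k n * h n : ℝ) : 𝕜) • z)
      ≤ k n * h n * (ε / 8 + ε / 16) := by
    refine seminorm_pow_sub_le (G n) P hn.le hG _ fun j hj => ?_
    have hjk : (j : ℝ) * h n ≤ k n * h n := by gcongr
    have e : (G n ^ j) (B n) - z = ((G n ^ j) z - z) - (G n ^ j) (z - B n) := by
      rw [map_sub]; abel
    rw [e]
    have h2 := map_sub_le_add P ((G n ^ j) z - z) ((G n ^ j) (z - B n))
    have h3 := hE j (hjk.trans hk2.le) (z - B n)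
    have h4 := hδn j (hjk.trans hk1.le)
    linarith
  have h1' : (k n * h n : ℝ) * (ε / 8 + ε / 16) ≤ 2 * r * (ε / 8 + ε / 16) := by gcongr
  have hr0 : (r : 𝕜) ≠ 0 := by exact_mod_cast hr.ne'
  have e : ((r : 𝕜)⁻¹) • ((G n ^ k n) g - g) - z = ((r⁻¹ : ℝ) : 𝕜) •
      ((G n ^ k n) (g - u n) - (g - u n)
        + (((G n ^ k n) (u n) - u n - ((k n * h n : ℝ) : 𝕜) • z)
          + ((k n * h n - r : ℝ) : 𝕜) • z)) := by
    have : z = ((r : 𝕜)⁻¹) • ((r : 𝕜) • z) := by rw [smul_smul, inv_mul_cancel₀ hr0, one_smul]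
    nth_rw 1 [this]
    rw [← smul_sub, RCLike.ofReal_inv, map_sub]
    congr 1
    push_cast
    module
  rw [e, seminorm_ofReal_smul P (by positivity), inv_mul_lt_iff₀ hr]
  have h2 := map_add_le_add P ((G n ^ k n) (g - u n) - (g - u n))
    (((G n ^ k n) (u n) - u n - ((k n * h n : ℝ) : 𝕜) • z) + ((k n * h n - r : ℝ) : 𝕜) • z)
  have h3 := map_add_le_add P ((G n ^ k n) (u n) - u n - ((k n * h n : ℝ) : 𝕜) • z)
    (((k n * h n - r : ℝ) : 𝕜) • z)
  have h4 := map_sub_le_add P ((G n ^ k n) (g - u n)) (g - u n)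
  have h5 := hE _ hk2.le (g - u n)
  have h6 : P (g - u n) ≤ Q (g - u n) := hPQ _
  have h7 : P (((k n * h n - r : ℝ) : 𝕜) • z) < r * ε / 16 := by
    rw [map_smul_eq_mul, RCLike.norm_ofReal]
    rwa [abs_mul, abs_of_nonneg (apply_nonneg P z)] at hkz
  have h8 : 0 < r * ε := by positivity
  linarith

/-- The closure of the approximate derivative is single-valued at `0`. -/
lemma eq_zero_of_mem_closure [T2Space X] {p : SeminormFamily 𝕜 X ι} (hp : WithSeminorms p)
    (H : IsStableScheme G h) {z : X} (hz : ((0 : X), z) ∈ closure (limGraph G h)) : z = 0 := by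
  refine (eq_of_forall_seminorm hp fun P hP ε hε => ?_).symm
  obtain ⟨δ, hδ, hE⟩ := H.eventually_quotient_sub_lt hz hP hε
  obtain ⟨n, hn⟩ := (hE δ hδ le_rfl _ (H.tendsto_floor_mul hδ.le)).exists
  simpa using hn

/-- One step of a polygon: if the speed of the segment from `g₀` to `g₁` is `η`-close to the
derivatives `z₀` and `z₁` at its end points, then the scheme leads from `g₀` to `g₁` with an error
of at most `δ η`. -/
lemma eventually_segment_lt (H : IsStableScheme G h) {P Q : Seminorm 𝕜 X} (hQ : Continuous Q)
    (hPQ : P ≤ Q) {S : ℝ}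
    (hE : ∀ᶠ n in atTop, ∀ m : ℕ, m * h n ≤ S → ∀ x, P ((G n ^ m) x) ≤ Q x)
    {δ : ℝ} (hδ : 0 < δ) (hδS : δ < S) {g₀ z₀ g₁ z₁ : X}
    (h₀ : (g₀, z₀) ∈ closure (limGraph G h)) (h₁ : (g₁, z₁) ∈ closure (limGraph G h)) {η : ℝ}
    (hη₀ : Q (z₀ - ((δ : 𝕜)⁻¹) • (g₁ - g₀)) ≤ η) (hη₁ : Q (z₁ - ((δ : 𝕜)⁻¹) • (g₁ - g₀)) ≤ η)
    {k : ℕ → ℕ} (hk : Tendsto (fun n => k n * h n) atTop (𝓝 δ)) {ε : ℝ} (hε : 0 < ε) :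
    ∀ᶠ n in atTop, P ((G n ^ k n) g₀ - g₁) < δ * η + ε := by
  -- all perturbations below are of size `ρ`, and their total effect is `(3 δ + 12) ρ = ε / 2`
  set ρ := ε / (2 * (3 * δ + 12)) with hρ
  have hρ0 : 0 < ρ := by positivity
  have hρε : (3 * δ + 12) * ρ = ε / 2 := by rw [hρ]; field_simp
  obtain ⟨g₀', z₀', ⟨u₀, B₀, hu₀, hB₀, hG₀⟩, hg₀', hz₀'⟩ := exists_mem_of_mem_closure h₀ hQ hρ0
  obtain ⟨g₁', z₁', ⟨u₁, B₁, hu₁, hB₁, hG₁⟩, hg₁', hz₁'⟩ := exists_mem_of_mem_closure h₁ hQ hρ0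
  have hlim : Tendsto (fun n => k n * h n * (η + 3 * ρ + 8 * ρ / δ) + 4 * ρ) atTop
      (𝓝 (δ * (η + 3 * ρ + 8 * ρ / δ) + 4 * ρ)) := (hk.mul_const _).add_const _
  have hval : δ * (η + 3 * ρ + 8 * ρ / δ) + 4 * ρ < δ * η + ε := by
    have : δ * (η + 3 * ρ + 8 * ρ / δ) + 4 * ρ = δ * η + (3 * δ + 12) * ρ := by
      field_simp; ring
    rw [this, hρε]; linarith
  have hinv : Tendsto (fun n => |(k n * h n)⁻¹ - δ⁻¹| * Q (g₁ - g₀)) atTop (𝓝 0) := by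
    simpa using ((hk.inv₀ hδ.ne').sub_const δ⁻¹).abs.mul_const (Q (g₁ - g₀))
  filter_upwards [hE, H.pos, hG₀, hG₁, eventually_seminorm_sub_lt hQ hu₀ hρ0,
    eventually_seminorm_sub_lt hQ hB₀ hρ0, eventually_seminorm_sub_lt hQ hu₁ hρ0,
    eventually_seminorm_sub_lt hQ hB₁ hρ0, hlim.eventually_lt_const hval,
    hinv.eventually_lt_const hρ0, hk.eventually_lt_const hδS,
    hk.eventually_const_lt (show δ / 2 < δ by linarith)]
    with n hE hn hG₀ hG₁ hu₀ hB₀ hu₁ hB₁ hlim hinv hkS hkδ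
  have tri : ∀ a b c : X, Q (a - c) < ρ → Q (b - c) < ρ → Q (a - b) < 2 * ρ := by
    intro a b c h1 h2
    have := map_sub_le_add Q (a - c) (b - c)
    rw [sub_sub_sub_cancel_right] at this
    linarith
  have e₀ := tri _ _ _ hg₀' hu₀
  have e₁ := tri _ _ _ hg₁' hu₁
  have f₀ := tri _ _ _ hB₀ hz₀'
  have f₁ := tri _ _ _ hB₁ hz₁'
  set κ : ℝ := k n * h n with hκ
  have hκ0 : 0 < κ := by linarith
  have hκ' : (κ : 𝕜) ≠ 0 := by exact_mod_cast hκ0.ne'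
  have hk0 : 0 < k n := by
    rcases Nat.eq_zero_or_pos (k n) with h0 | h0
    · rw [hκ, h0] at hκ0; simp at hκ0
    · exact h0
  set c : X := ((κ⁻¹ : ℝ) : 𝕜) • (u₁ n - u₀ n) with hc
  have hcΔ : Q (((δ : 𝕜)⁻¹) • (g₁ - g₀) - c) ≤ 8 * ρ / δ + ρ := by
    have e : ((δ : 𝕜)⁻¹) • (g₁ - g₀) - c = ((κ⁻¹ : ℝ) : 𝕜) • ((g₁ - u₁ n) - (g₀ - u₀ n))
        - ((κ⁻¹ - δ⁻¹ : ℝ) : 𝕜) • (g₁ - g₀) := by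
      rw [hc]; push_cast; module
    rw [e]
    refine (map_sub_le_add Q _ _).trans (add_le_add ?_ ?_)
    · rw [seminorm_ofReal_smul Q (by positivity)]
      have h1 := map_sub_le_add Q (g₁ - u₁ n) (g₀ - u₀ n)
      have h2 : κ⁻¹ ≤ (δ / 2)⁻¹ := inv_anti₀ (by positivity) hkδ.le
      calc κ⁻¹ * Q ((g₁ - u₁ n) - (g₀ - u₀ n)) ≤ (δ / 2)⁻¹ * (4 * ρ) := by
            gcongr; linarith
        _ = 8 * ρ / δ := by field_simp; ring
    · rw [map_smul_eq_mul, RCLike.norm_ofReal]; exact hinv.le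
  have bound : ∀ B z : X, Q (B - z) < 2 * ρ → Q (z - ((δ : 𝕜)⁻¹) • (g₁ - g₀)) ≤ η →
      Q (B - c) ≤ η + 3 * ρ + 8 * ρ / δ := by
    intro B z h1 h2
    have h3 := map_add_le_add Q (B - z)
      ((z - ((δ : 𝕜)⁻¹) • (g₁ - g₀)) + (((δ : 𝕜)⁻¹) • (g₁ - g₀) - c))
    have h4 := map_add_le_add Q (z - ((δ : 𝕜)⁻¹) • (g₁ - g₀)) (((δ : 𝕜)⁻¹) • (g₁ - g₀) - c)
    rw [sub_add_sub_cancel] at h3 h4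
    rw [sub_add_sub_cancel] at h3
    linarith
  have key := seminorm_pow_sub_segment_le (G n) P Q hn.le hG₀ hG₁ hk0 (c := c)
    (by rw [hc, smul_smul, ← hκ, RCLike.ofReal_inv, mul_inv_cancel₀ hκ', one_smul])
    (fun j hj x => hE j (by
      refine le_trans ?_ hkS.le
      rw [hκ]
      gcongr) x) (bound _ _ f₀ hη₀) (bound _ _ f₁ hη₁)
  have e : (G n ^ k n) g₀ - g₁
      = (G n ^ k n) (g₀ - u₀ n) + (((G n ^ k n) (u₀ n) - u₁ n) - (g₁ - u₁ n)) := by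
    rw [map_sub]; abel
  rw [e]
  have h2 := map_add_le_add P ((G n ^ k n) (g₀ - u₀ n))
    (((G n ^ k n) (u₀ n) - u₁ n) - (g₁ - u₁ n))
  have h3 := map_sub_le_add P ((G n ^ k n) (u₀ n) - u₁ n) (g₁ - u₁ n)
  have h4 := hE _ hkS.le (g₀ - u₀ n)
  have h5 : P (g₁ - u₁ n) ≤ Q (g₁ - u₁ n) := hPQ _
  linarith

/-- A polygon `y 0, …, y M` with time step `δ` whose speeds are `η`-close to the derivatives at its
vertices is followed by the scheme with an error of at most `M δ η`. -/
theorem eventually_polygon_lt (H : IsStableScheme G h) {P : Seminorm 𝕜 X} (hP : Continuous P)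
    (S : ℝ) : ∃ R : Seminorm 𝕜 X, Continuous R ∧ ∀ δ η : ℝ, 0 < δ → ∀ (M : ℕ) (y z : ℕ → X),
      M * δ ≤ S → (∀ i ≤ M, (y i, z i) ∈ closure (limGraph G h)) →
      (∀ i < M, R (z i - ((δ : 𝕜)⁻¹) • (y (i + 1) - y i)) ≤ η ∧
        R (z (i + 1) - ((δ : 𝕜)⁻¹) • (y (i + 1) - y i)) ≤ η) →
      ∀ μ : ℕ → ℕ, Tendsto (fun n => μ n * h n) atTop (𝓝 (M * δ)) → ∀ ε > 0,
        ∀ᶠ n in atTop, P ((G n ^ μ n) (y 0) - y M) < M * δ * η + ε := by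
  obtain ⟨Q, hQ, hPQ, hE⟩ := H.equi P hP (S + 1)
  obtain ⟨R, hR, hQR, hE'⟩ := H.equi Q hQ (S + 1)
  refine ⟨R, hR, fun δ η hδ M => ?_⟩
  induction M with
  | zero =>
    intro y z _ _ _ μ hμ ε hε
    obtain ⟨δ', hδ', h1⟩ := H.eventually_pow_sub_lt (y 0) hP hε
    rw [Nat.cast_zero, zero_mul] at hμ
    filter_upwards [h1, hμ.eventually_lt_const hδ'] with n h1 h2
    simpa using h1 _ h2.le
  | succ M ih =>
    intro y z hS hyz hη μ hμ ε hε
    -- `k n` steps are spent on the first edge; the minimum matters only for `M = 0`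
    set k : ℕ → ℕ := fun n => min ⌊δ / h n⌋₊ (μ n) with hkdef
    have hMδ : (M : ℝ) * δ + δ = (M + 1 : ℕ) * δ := by push_cast; ring
    have hM0 : (0 : ℝ) ≤ M * δ := by positivity
    have hk : Tendsto (fun n => k n * h n) atTop (𝓝 δ) := by
      have h1 := (H.tendsto_floor_mul hδ.le).min hμ
      rw [min_eq_left (by linarith)] at h1
      refine h1.congr' ?_
      filter_upwards [H.pos] with n hn
      rw [hkdef, Nat.cast_min, min_mul_of_nonneg _ _ hn.le]
    have hkμ : ∀ n, (((μ n - k n : ℕ) : ℝ)) * h n = μ n * h n - k n * h n := by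
      intro n
      rw [Nat.cast_sub (min_le_right _ _)]; ring
    have hν : Tendsto (fun n => ((μ n - k n : ℕ) : ℝ) * h n) atTop (𝓝 (M * δ)) := by
      simp only [hkμ]
      have := hμ.sub hk
      rwa [← hMδ, add_sub_cancel_right] at this
    have h1 := H.eventually_segment_lt hR hQR hE' hδ (by linarith) (hyz 0 (Nat.zero_le _))
      (hyz 1 (by omega)) (hη 0 (by omega)).1 (hη 0 (by omega)).2 hk (show 0 < ε / 2 by linarith)
    have h2 := ih (fun i => y (i + 1)) (fun i => z (i + 1)) (by linarith)
      (fun i hi => hyz (i + 1) (by omega)) (fun i hi => hη (i + 1) (by omega)) _ hν (ε / 2)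
      (by linarith)
    filter_upwards [h1, h2, hE, hν.eventually_lt_const (show M * δ < S + 1 by linarith)]
      with n h1 h2 hE hS
    have e : (G n ^ μ n) (y 0) - y (M + 1)
        = (G n ^ (μ n - k n)) ((G n ^ k n) (y 0) - y 1)
          + ((G n ^ (μ n - k n)) (y 1) - y (M + 1)) := by
      nth_rw 1 [show μ n = (μ n - k n) + k n from (Nat.sub_add_cancel (min_le_right _ _)).symm]
      rw [pow_add_apply, map_sub]; abel
    rw [e, ← hMδ]
    have h3 := map_add_le_add P ((G n ^ (μ n - k n)) ((G n ^ k n) (y 0) - y 1))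
      ((G n ^ (μ n - k n)) (y 1) - y (M + 1))
    have h4 := hE _ hS.le ((G n ^ k n) (y 0) - y 1)
    rw [zero_add] at h2
    linarith

end IsStableScheme

namespace IsStableScheme

variable [TopologicalSpace X] [IsTopologicalAddGroup X] {G : ℕ → X →L[𝕜] X} {h : ℕ → ℝ}

/-- If the scheme carries `f` to `y` along a filter, and both `f` and `y` have derivatives, then it
carries the derivative of `f` to that of `y`. -/
lemma tendsto_pow_derivative {p : SeminormFamily 𝕜 X ι} (hp : WithSeminorms p)
    (H : IsStableScheme G h) {f w y z : X} (hf : (f, w) ∈ closure (limGraph G h))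
    (hy : (y, z) ∈ closure (limGraph G h)) {L : Filter ℕ} (hL : L ≤ atTop) {m : ℕ → ℕ} {s : ℝ}
    (hs : 0 ≤ s) (hm : Tendsto (fun n => m n * h n) atTop (𝓝 s))
    (hlim : Tendsto (fun n => (G n ^ m n) f) L (𝓝 y)) :
    Tendsto (fun n => (G n ^ m n) w) L (𝓝 z) := by
  refine tendsto_of_forall_seminorm hp fun P hP ε hε => ?_
  obtain ⟨Q, hQ, hPQ, hE⟩ := H.equi P hP (s + 1)
  obtain ⟨δ₁, hδ₁, h1⟩ := H.eventually_quotient_sub_lt hf hQ (show 0 < ε / 4 by linarith)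
  obtain ⟨δ₂, hδ₂, h2⟩ := H.eventually_quotient_sub_lt hy hP (show 0 < ε / 4 by linarith)
  set r : ℝ := min (1 / 2) (min δ₁ δ₂) with hr
  have hr0 : 0 < r := by positivity
  have hr1 : r ≤ 1 / 2 := min_le_left _ _
  have hk := H.tendsto_floor_mul hr0.le
  have h1 := h1 r hr0 ((min_le_right _ _).trans (min_le_left _ _)) _ hk
  have h2 := h2 r hr0 ((min_le_right _ _).trans (min_le_right _ _)) _ hk
  set k : ℕ → ℕ := fun n => ⌊r / h n⌋₊ with hkdef
  filter_upwards [hL h1, hL h2, hL hE, hL (hm.eventually_lt_const (show s < s + 1 by linarith)),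
    hL (hk.eventually_lt_const (show r < s + 1 by linarith)),
    eventually_seminorm_sub_lt hQ hlim (show 0 < r * ε / 8 by positivity)]
    with n h1 h2 hE hm hk hv
  have e : (G n ^ m n) w - z
      = ((((r : 𝕜)⁻¹) • ((G n ^ k n) y - y) - z)
        - (G n ^ m n) (((r : 𝕜)⁻¹) • ((G n ^ k n) f - f) - w))
        + ((r⁻¹ : ℝ) : 𝕜) • ((G n ^ k n) ((G n ^ m n) f - y) - ((G n ^ m n) f - y)) := by
    have hc : (G n ^ m n) ((G n ^ k n) f) = (G n ^ k n) ((G n ^ m n) f) := by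
      rw [← pow_add_apply, ← pow_add_apply, add_comm]
    rw [map_sub, map_smul, map_sub, hc, map_sub, RCLike.ofReal_inv]
    module
  rw [e]
  have t1 := map_add_le_add P ((((r : 𝕜)⁻¹) • ((G n ^ k n) y - y) - z)
    - (G n ^ m n) (((r : 𝕜)⁻¹) • ((G n ^ k n) f - f) - w))
    (((r⁻¹ : ℝ) : 𝕜) • ((G n ^ k n) ((G n ^ m n) f - y) - ((G n ^ m n) f - y)))
  have t2 := map_sub_le_add P (((r : 𝕜)⁻¹) • ((G n ^ k n) y - y) - z)
    ((G n ^ m n) (((r : 𝕜)⁻¹) • ((G n ^ k n) f - f) - w))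
  have t3 := hE _ hm.le (((r : 𝕜)⁻¹) • ((G n ^ k n) f - f) - w)
  have t4 := map_sub_le_add P ((G n ^ k n) ((G n ^ m n) f - y)) ((G n ^ m n) f - y)
  have t5 := hE _ hk.le ((G n ^ m n) f - y)
  have t6 : P ((G n ^ m n) f - y) ≤ Q ((G n ^ m n) f - y) := hPQ _
  rw [seminorm_ofReal_smul P (by positivity)] at t1
  have t7 : r⁻¹ * P ((G n ^ k n) ((G n ^ m n) f - y) - ((G n ^ m n) f - y)) ≤ ε / 4 := by
    rw [inv_mul_le_iff₀ hr0]
    linarith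
  linarith

/-- If the limit points of the scheme started at `f`, along some filter `L` and at the times
`0, s / M, 2 s / M, …, s`, have derivatives, then the whole sequence stays close to the last of
them: these limit points are the vertices of a polygon that the scheme follows. -/
theorem eventually_pow_sub_limit_lt [T2Space X] {p : SeminormFamily 𝕜 X ι} (hp : WithSeminorms p)
    (H : IsStableScheme G h) {f w : X} (hf : (f, w) ∈ closure (limGraph G h)) {s : ℝ} (hs : 0 < s)
    {P : Seminorm 𝕜 X} (hP : Continuous P) {ε : ℝ} (hε : 0 < ε) :
    ∃ δ₀ > 0, ∀ M : ℕ, 0 < M → s / M ≤ δ₀ → ∀ L : Filter ℕ, L.NeBot → L ≤ atTop →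
      ∀ y z : ℕ → X, (∀ i ≤ M, (y i, z i) ∈ closure (limGraph G h)) →
      (∀ i ≤ M, Tendsto (fun n => (G n ^ (i * ⌊s / M / h n⌋₊)) f) L (𝓝 (y i))) →
      ∀ μ : ℕ → ℕ, Tendsto (fun n => μ n * h n) atTop (𝓝 s) →
        ∀ᶠ n in atTop, P ((G n ^ μ n) f - y M) < ε := by
  have := hp.continuousSMul
  obtain ⟨R, hR, hpoly⟩ := H.eventually_polygon_lt hP s
  obtain ⟨Q, hQ, hRQ, hE⟩ := H.equi R hR (s + 1)
  set η : ℝ := ε / (4 * s) with hη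
  have hη0 : 0 < η := by positivity
  obtain ⟨δ₁, hδ₁, h1⟩ := H.eventually_quotient_sub_lt hf hQ hη0
  obtain ⟨δ₂, hδ₂, h2⟩ := H.eventually_pow_sub_lt w hQ hη0
  refine ⟨min δ₁ (δ₂ / 2), by positivity, fun M hM hMδ L hLne hL y z hyz hy μ hμ => ?_⟩
  have hMR : (0 : ℝ) < M := by exact_mod_cast hM
  set δ : ℝ := s / M with hδ
  have hδ0 : 0 < δ := by positivity
  have hδs : M * δ = s := by rw [hδ]; field_simp
  have hk := H.tendsto_floor_mul hδ0.le
  have h1 := h1 δ hδ0 (hMδ.trans (min_le_left _ _)) _ hk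
  have hδ₂' : δ < δ₂ := by linarith [hMδ.trans (min_le_right _ _)]
  set k : ℕ → ℕ := fun n => ⌊δ / h n⌋₊ with hkdef
  have hik : ∀ i : ℕ, Tendsto (fun n => (i * k n : ℕ) * h n) atTop (𝓝 (i * δ)) := by
    intro i
    refine (hk.const_mul (i : ℝ)).congr fun n => ?_
    push_cast; ring
  have hiS : ∀ i ≤ M, ∀ᶠ n in L, ∀ x, R ((G n ^ (i * k n)) x) ≤ Q x := by
    intro i hi
    have : (i : ℝ) * δ < s + 1 := by
      have : (i : ℝ) * δ ≤ M * δ := by gcongr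
      linarith
    filter_upwards [hL ((hik i).eventually_lt_const this), hL hE] with n h1 h2 x
    exact h2 _ h1.le x
  have hz : ∀ i ≤ M, Tendsto (fun n => (G n ^ (i * k n)) w) L (𝓝 (z i)) := fun i hi =>
    H.tendsto_pow_derivative hp hf (hyz i hi) hL (by positivity) (hik i) (hy i hi)
  have hy0 : y 0 = f := by
    refine tendsto_nhds_unique (hy 0 (Nat.zero_le _)) ?_
    simp
  have hstep : ∀ (x : X) (n i : ℕ),
      (G n ^ ((i + 1) * k n)) x = (G n ^ (i * k n)) ((G n ^ k n) x) := by
    intro x n i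
    rw [add_mul, one_mul, pow_add_apply]
  -- `z i` and the slope of the `i`-th edge are limits along `L` of images under `G n ^ (i * k n)` of
  -- `w` and of a difference quotient of `f`, which are close to each other by the choice of `δ`
  have hA : ∀ i < M, R (z i - ((δ : 𝕜)⁻¹) • (y (i + 1) - y i)) ≤ η := by
    intro i hi
    have hlim := (hz i hi.le).sub (((hy (i + 1) hi).sub (hy i hi.le)).const_smul ((δ : 𝕜)⁻¹))
    refine le_of_tendsto ((hR.tendsto _).comp hlim) ?_
    filter_upwards [hiS i hi.le, hL h1] with n hn h1
    have e : (G n ^ (i * k n)) w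
        - ((δ : 𝕜)⁻¹) • ((G n ^ ((i + 1) * k n)) f - (G n ^ (i * k n)) f)
        = (G n ^ (i * k n)) (w - ((δ : 𝕜)⁻¹) • ((G n ^ k n) f - f)) := by
      rw [hstep, map_sub, map_smul, map_sub]
    rw [Function.comp_apply, e]
    refine (hn _).trans ?_
    rw [map_sub_rev]
    exact h1.le
  have hB : ∀ i < M, R (z (i + 1) - z i) ≤ η := by
    intro i hi
    refine le_of_tendsto ((hR.tendsto _).comp ((hz (i + 1) hi).sub (hz i hi.le))) ?_
    filter_upwards [hiS i hi.le, hL h2, hL (hk.eventually_lt_const hδ₂')] with n hn h2 hk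
    rw [Function.comp_apply, hstep, ← map_sub]
    exact (hn _).trans (h2 _ hk.le).le
  have key := hpoly δ (2 * η) hδ0 M y z hδs.le hyz
    (fun i hi => ⟨(hA i hi).trans (by linarith), ?_⟩) μ (by rwa [hδs]) (ε / 2) (by linarith)
  · have : (M : ℝ) * δ * (2 * η) + ε / 2 = ε := by
      rw [hδs, hη]; field_simp; ring
    rw [this, hy0] at key
    exact key
  · have := map_add_le_add R (z (i + 1) - z i) (z i - ((δ : 𝕜)⁻¹) • (y (i + 1) - y i))
    rw [sub_add_sub_cancel] at this
    linarith [hA i hi, hB i hi]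

/-- A smooth orbit `y` of the derivative, with difference quotients that converge uniformly on
`[0, s]`, attracts the scheme started at `y 0`. -/
theorem tendsto_pow_of_smooth {p : SeminormFamily 𝕜 X ι} (hp : WithSeminorms p)
    (H : IsStableScheme G h) {s : ℝ} (hs : 0 ≤ s) {y z : ℝ → X}
    (hyz : ∀ r, 0 ≤ r → (y r, z r) ∈ closure (limGraph G h))
    (hsmooth : ∀ R : Seminorm 𝕜 X, Continuous R → ∀ η > 0, ∃ δ₀ > 0, ∀ δ : ℝ, 0 < δ → δ ≤ δ₀ →
      ∀ r : ℝ, 0 ≤ r → r ≤ s → R (z r - ((δ : 𝕜)⁻¹) • (y (r + δ) - y r)) ≤ η ∧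
        R (z (r + δ) - ((δ : 𝕜)⁻¹) • (y (r + δ) - y r)) ≤ η)
    {μ : ℕ → ℕ} (hμ : Tendsto (fun n => μ n * h n) atTop (𝓝 s)) :
    Tendsto (fun n => (G n ^ μ n) (y 0)) atTop (𝓝 (y s)) := by
  refine tendsto_of_forall_seminorm hp fun P hP ε hε => ?_
  obtain ⟨R, hR, hpoly⟩ := H.eventually_polygon_lt hP s
  obtain ⟨δ₀, hδ₀, hδ⟩ := hsmooth R hR (ε / (2 * (s + 1))) (by positivity)
  rcases hs.eq_or_lt with rfl | hs0
  · have := hpoly 1 0 one_pos 0 (fun _ => y 0) (fun _ => z 0) (by simp)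
      (fun i _ => hyz 0 le_rfl) (by simp) μ (by simpa using hμ) ε hε
    simpa using this
  obtain ⟨M, hM⟩ := exists_nat_gt (s / δ₀)
  have hMR : (0 : ℝ) < M := lt_of_le_of_lt (by positivity) hM
  set δ : ℝ := s / M with hδdef
  have hδ0 : 0 < δ := by positivity
  have hδs : M * δ = s := by rw [hδdef]; field_simp
  have hδδ₀ : δ ≤ δ₀ := by
    rw [hδdef, div_le_iff₀ hMR]
    rw [div_lt_iff₀ hδ₀] at hM
    linarith
  have hstep : ∀ i : ℕ, ((i + 1 : ℕ) : ℝ) * δ = i * δ + δ := fun i => by push_cast; ring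
  have key := hpoly δ _ hδ0 M (fun i => y (i * δ)) (fun i => z (i * δ)) hδs.le
    (fun i _ => hyz _ (by positivity)) (fun i hi => by
      have hi' : (i : ℝ) * δ ≤ s := by
        rw [← hδs]; gcongr
      simp only [hstep]
      exact hδ δ hδ0 hδδ₀ (i * δ) (by positivity) hi') μ (by rwa [hδs]) (ε / 2) (by linarith)
  have hlt : s * (ε / (2 * (s + 1))) ≤ ε / 2 := by
    rw [mul_div_assoc', div_le_div_iff₀ (by positivity) (by positivity)]
    nlinarith
  simp only [hδs, Nat.cast_zero, zero_mul] at key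
  filter_upwards [key] with n hn
  linarith

end IsStableScheme

/-! ### Equicontinuity in terms of continuous seminorms -/

lemma EquicontinuousFamily.exists_seminorm [TopologicalSpace X] [IsTopologicalAddGroup X]
    {p : SeminormFamily 𝕜 X ι} (hp : WithSeminorms p) {B : Set (X →L[𝕜] X)}
    (hB : EquicontinuousFamily p B) {P : Seminorm 𝕜 X} (hP : Continuous P) :
    ∃ Q : Seminorm 𝕜 X, Continuous Q ∧ ∀ G ∈ B, ∀ x, P (G x) ≤ Q x := by
  classical
  obtain ⟨J, C, -, hPC⟩ := Seminorm.bound_of_continuous hp P hP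
  choose K b hb hKb using hB
  have := hp.continuousSMul
  refine ⟨C • ∑ i ∈ J, ∑ j ∈ K i, (b i j).toNNReal • p j, ?_, fun G hG x => ?_⟩
  · refine Continuous.const_smul (Seminorm.continuous_finsetSum fun i _ =>
      Seminorm.continuous_finsetSum fun j _ => ?_) C
    exact (hp.continuous_seminorm j).const_smul _
  · have h1 : P (G x) ≤ C * ∑ i ∈ J, p i (G x) := by
      refine (hPC _).trans ?_
      have := Seminorm.finset_sup_le_sum p J (G x)
      rw [_root_.sum_apply] at this
      rw [_root_.smul_apply, NNReal.smul_def, smul_eq_mul]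
      gcongr
    refine h1.trans ?_
    rw [_root_.smul_apply, NNReal.smul_def, smul_eq_mul, _root_.sum_apply]
    refine mul_le_mul_of_nonneg_left (Finset.sum_le_sum fun i _ => ?_) C.2
    refine (hKb i G hG x).trans (le_of_eq ?_)
    rw [_root_.sum_apply]
    refine Finset.sum_congr rfl fun j hj => ?_
    rw [_root_.smul_apply, NNReal.smul_def, smul_eq_mul, Real.coe_toNNReal _ (hb i j hj).le]

lemma equicontinuousFamily_of_exists_seminorm [TopologicalSpace X]
    {p : SeminormFamily 𝕜 X ι} (hp : WithSeminorms p) {B : Set (X →L[𝕜] X)}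
    (hB : ∀ P : Seminorm 𝕜 X, Continuous P →
      ∃ Q : Seminorm 𝕜 X, Continuous Q ∧ ∀ G ∈ B, ∀ x, P (G x) ≤ Q x) :
    EquicontinuousFamily p B := by
  classical
  intro α
  obtain ⟨Q, hQ, hBQ⟩ := hB (p α) (hp.continuous_seminorm α)
  obtain ⟨J, C, hC, hQC⟩ := Seminorm.bound_of_continuous hp Q hQ
  refine ⟨J, fun _ => C, fun _ _ => by positivity, fun G hG x => (hBQ G hG x).trans ?_⟩
  refine (hQC x).trans ?_
  have := Seminorm.finset_sup_le_sum p J x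
  rw [_root_.sum_apply] at this
  rw [_root_.smul_apply, NNReal.smul_def, smul_eq_mul, ← Finset.mul_sum]
  gcongr

/-! ### Semigroups -/

section Semigroup

variable [TopologicalSpace X]

/-- Local equicontinuity of a semigroup; `P ≤ Q` comes from the operator at time `0`. -/
lemma IsLC0Semigroup.exists_seminorm [IsTopologicalAddGroup X] {p : SeminormFamily 𝕜 X ι}
    (hp : WithSeminorms p) {T : ℝ≥0 → X →L[𝕜] X} (hT : IsLC0Semigroup p T) {P : Seminorm 𝕜 X}
    (hP : Continuous P) (S : ℝ≥0) :
    ∃ Q : Seminorm 𝕜 X, Continuous Q ∧ P ≤ Q ∧ ∀ s ≤ S, ∀ x, P (T s x) ≤ Q x := by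
  obtain ⟨Q, hQ, h⟩ := (hT.classE.2 S).exists_seminorm hp hP
  have h' : ∀ s ≤ S, ∀ x, P (T s x) ≤ Q x := fun s hs x =>
    h _ ⟨s, 1, 1, le_rfl, le_rfl, by simpa using hs, by simp⟩ x
  exact ⟨Q, hQ, fun x => by simpa [hT.map_zero] using h' 0 bot_le x, h'⟩

lemma pow_eq_of_map_add {T : ℝ≥0 → X →L[𝕜] X} (h0 : T 0 = ContinuousLinearMap.id 𝕜 X)
    (hadd : ∀ l m : ℝ≥0, T (l + m) = (T l).comp (T m)) (s : ℝ≥0) (m : ℕ) :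
    T s ^ m = T (m * s) := by
  induction m with
  | zero => rw [Nat.cast_zero, zero_mul, h0, pow_zero]; rfl
  | succ m ih => rw [pow_succ, ih, Nat.cast_succ, add_mul, one_mul, hadd]; rfl

lemma isLC0Semigroup_of_exists_seminorm [IsTopologicalAddGroup X] {p : SeminormFamily 𝕜 X ι}
    (hp : WithSeminorms p) {T : ℝ≥0 → X →L[𝕜] X} (h0 : T 0 = ContinuousLinearMap.id 𝕜 X)
    (hadd : ∀ l m : ℝ≥0, T (l + m) = (T l).comp (T m))
    (hequi : ∀ P : Seminorm 𝕜 X, Continuous P → ∀ S : ℝ≥0, ∃ Q : Seminorm 𝕜 X, Continuous Q ∧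
      ∀ s ≤ S, ∀ x, P (T s x) ≤ Q x)
    (hcont : ∀ x, ∀ P : Seminorm 𝕜 X, Continuous P → ∀ ε > 0, ∃ δ > 0, ∀ s : ℝ≥0, (s : ℝ) ≤ δ →
      P (T s x - x) < ε) :
    IsLC0Semigroup p T := by
  refine ⟨h0, hadd, fun x => continuous_iff_continuousAt.2 fun s => ?_, h0, fun S => ?_⟩
  · refine tendsto_of_forall_seminorm hp fun P hP ε hε => ?_
    obtain ⟨Q, hQ, hE⟩ := hequi P hP (s + 1)
    obtain ⟨δ, hδ, h⟩ := hcont x Q hQ ε hε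
    have key : ∀ a b : ℝ≥0, a ≤ b → a ≤ s + 1 → (b : ℝ) - a ≤ δ → P (T b x - T a x) < ε := by
      intro a b hab ha hd
      have e : T b x - T a x = T a (T (b - a) x - x) := by
        have : b = a + (b - a) := (add_tsub_cancel_of_le hab).symm
        nth_rw 1 [this]
        rw [hadd, map_sub]; rfl
      rw [e]
      refine (hE a ha _).trans_lt (h _ ?_)
      rwa [NNReal.coe_sub hab]
    filter_upwards [Metric.ball_mem_nhds s (lt_min hδ one_pos)] with r hr
    rw [Metric.mem_ball, NNReal.dist_eq, lt_min_iff, abs_lt, abs_lt] at hr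
    rcases le_total s r with hsr | hsr
    · exact key s r hsr (by simp) (by linarith)
    · rw [map_sub_rev]
      exact key r s hsr (hsr.trans (by simp)) (by linarith)
  · refine equicontinuousFamily_of_exists_seminorm hp fun P hP => ?_
    obtain ⟨Q, hQ, hE⟩ := hequi P hP S
    refine ⟨Q, hQ, ?_⟩
    rintro _ ⟨d, n, m, -, -, hS, rfl⟩ x
    rw [pow_eq_of_map_add h0 hadd]
    exact hE _ (by rwa [← mul_div_assoc]) x

end Semigroup

lemma tendsto_div_nat {t : ℝ≥0} (ht : 0 < t) :
    Tendsto (fun n : ℕ => t / (n : ℝ≥0)) atTop (𝓝[>] 0) := by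
  refine tendsto_nhdsWithin_iff.2 ⟨tendsto_const_div_atTop_nhds_zero_nat t, ?_⟩
  filter_upwards [eventually_gt_atTop 0] with n hn
  have : (0 : ℝ≥0) < n := by exact_mod_cast hn
  exact div_pos ht this

lemma seminorm_average_sub_le (P : Seminorm 𝕜 X) {N : ℕ} (hN : 0 < N) {v : ℕ → X} {c : X} {b : ℝ}
    (h : ∀ i < N, P (v i - c) ≤ b) :
    P (((N : 𝕜)⁻¹) • ∑ i ∈ Finset.range N, v i - c) ≤ b := by
  have hN' : (N : 𝕜) ≠ 0 := by exact_mod_cast hN.ne'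
  have hNR : (0 : ℝ) < N := by exact_mod_cast hN
  have e : ((N : 𝕜)⁻¹) • ∑ i ∈ Finset.range N, v i - c
      = (((N : ℝ)⁻¹ : ℝ) : 𝕜) • ∑ i ∈ Finset.range N, (v i - c) := by
    rw [Finset.sum_sub_distrib, Finset.sum_const, Finset.card_range, smul_sub, RCLike.ofReal_inv,
      RCLike.ofReal_natCast, ← Nat.cast_smul_eq_nsmul 𝕜, smul_smul, inv_mul_cancel₀ hN', one_smul]
  rw [e, seminorm_ofReal_smul P (by positivity), inv_mul_le_iff₀ hNR]
  refine (Finset.le_sum_of_subadditive P (map_zero P).le (map_add_le_add P) _ _).trans ?_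
  simpa using Finset.sum_le_sum fun i hi => h i (Finset.mem_range.1 hi)

/-- Let a subspace `Γ` of `X × X` contain the orbits `(T s a, T s w)`, where `a` runs through a dense
set and `w` is the derivative of `T` at `a`. Then the closure of `Γ` contains every pair `(x, y)` such
that `y` is the derivative of `T` at `x`: the pair is approximated by the Riemann sums
`N⁻¹ ∑ (T (i r / N) a, T (i r / N) w)`, for `r` small, then `a` close to `x`, then `N` large. -/
lemma mem_closure_of_tendsto_quotient [TopologicalSpace X] [IsTopologicalAddGroup X]
    {p : SeminormFamily 𝕜 X ι} (hp : WithSeminorms p) {T : ℝ≥0 → X →L[𝕜] X}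
    (hT : IsLC0Semigroup p T) {Γ : Submodule 𝕜 (X × X)} {A : Set X} (hA : Dense A)
    (hAΓ : ∀ a ∈ A, ∃ w, (∀ s, (T s a, T s w) ∈ Γ) ∧
      Tendsto (fun h : ℝ≥0 => (((h : ℝ) : 𝕜)⁻¹) • (T h a - a)) (𝓝[>] 0) (𝓝 w))
    {x y : X} (hxy : Tendsto (fun h : ℝ≥0 => (((h : ℝ) : 𝕜)⁻¹) • (T h x - x)) (𝓝[>] 0) (𝓝 y)) :
    (x, y) ∈ closure (Γ : Set (X × X)) := by
  refine mem_closure_of_forall_seminorm hp fun P hP ε hε => ?_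
  obtain ⟨Q, hQ, hPQ, hE⟩ := hT.exists_seminorm hp hP 1
  have hc : ∀ᶠ r : ℝ≥0 in 𝓝 0, P (T r x - x) < ε / 4 := by
    have h1 := (hT.continuous x).tendsto 0
    rw [hT.map_zero] at h1
    exact eventually_seminorm_sub_lt hP h1 (by linarith)
  obtain ⟨δ, hδ, hc⟩ := Metric.eventually_nhds_iff.1 hc
  have hsmall : ∀ᶠ r : ℝ≥0 in 𝓝[>] 0, (r : ℝ) < min δ 1 := by
    refine Filter.Eventually.filter_mono nhdsWithin_le_nhds ?_
    have : Tendsto (fun r : ℝ≥0 => (r : ℝ)) (𝓝 0) (𝓝 0) := NNReal.continuous_coe.tendsto 0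
    exact this.eventually_lt_const (by positivity)
  obtain ⟨r, ⟨hr1, hr2⟩, hr0⟩ := (((eventually_seminorm_sub_lt hP hxy
    (show 0 < ε / 4 by linarith)).and hsmall).and self_mem_nhdsWithin).exists
  have hr0 : (0 : ℝ) < r := hr0
  have hr0' : ((r : ℝ) : 𝕜) ≠ 0 := by exact_mod_cast hr0.ne'
  have hrδ : (r : ℝ) < δ := hr2.trans_le (min_le_left _ _)
  have hr1' : (r : ℝ) < 1 := hr2.trans_le (min_le_right _ _)
  obtain ⟨a, ha, hxa⟩ := exists_mem_seminorm_sub_lt hA hQ x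
    (show 0 < min (ε / 8) (r * ε / 8) by positivity)
  have hxa1 : Q (x - a) < ε / 8 := hxa.trans_le (min_le_left _ _)
  have hxa2 : Q (x - a) < r * ε / 8 := hxa.trans_le (min_le_right _ _)
  obtain ⟨w, hwΓ, hw⟩ := hAΓ a ha
  obtain ⟨N, hN, hN0⟩ := (((tendsto_div_nat (by exact_mod_cast hr0 : 0 < r)).eventually (eventually_seminorm_sub_lt hQ hw
    (show 0 < ε / 4 by linarith))).and (eventually_gt_atTop 0)).exists
  have hNR : (0 : ℝ≥0) < N := by exact_mod_cast hN0
  have hN𝕜 : (N : 𝕜) ≠ 0 := by exact_mod_cast hN0.ne'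
  set σ : ℝ≥0 := r / N with hσ
  have hNσ : N * σ = r := by rw [hσ]; field_simp
  have hiσ : ∀ i < N, i * σ ≤ r := fun i hi => by
    rw [← hNσ]; gcongr
  have hi1 : ∀ i < N, i * σ ≤ 1 := fun i hi => (hiσ i hi).trans (by exact_mod_cast hr1'.le)
  refine ⟨((N : 𝕜)⁻¹) • ∑ i ∈ Finset.range N, T (i * σ) a,
    ((N : 𝕜)⁻¹) • ∑ i ∈ Finset.range N, T (i * σ) w, ?_, ?_, ?_⟩
  · have := Γ.smul_mem ((N : 𝕜)⁻¹) (Γ.sum_mem fun i (_ : i ∈ Finset.range N) => hwΓ (i * σ))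
    have e : ((N : 𝕜)⁻¹) • ∑ i ∈ Finset.range N, (T (i * σ) a, T (i * σ) w)
        = (((N : 𝕜)⁻¹) • ∑ i ∈ Finset.range N, T (i * σ) a,
          ((N : 𝕜)⁻¹) • ∑ i ∈ Finset.range N, T (i * σ) w) := by
      ext <;> simp [Prod.fst_sum, Prod.snd_sum]
    rw [e] at this
    exact this
  · refine (seminorm_average_sub_le P hN0 (b := ε / 8 + ε / 4) fun i hi => ?_).trans_lt
      (by linarith)
    have e : T (i * σ) a - x = (T (i * σ) x - x) - T (i * σ) (x - a) := by
      rw [map_sub]; abel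
    rw [e]
    have h1 := map_sub_le_add P (T (i * σ) x - x) (T (i * σ) (x - a))
    have h2 := hE _ (hi1 i hi) (x - a)
    have h3 : P (T (i * σ) x - x) < ε / 4 := hc (by
      rw [NNReal.dist_eq, NNReal.coe_zero, sub_zero, abs_of_nonneg (NNReal.coe_nonneg _)]
      exact lt_of_le_of_lt (by exact_mod_cast hiσ i hi) hrδ)
    linarith
  · set q : X := (((σ : ℝ) : 𝕜)⁻¹) • (T σ a - a) with hq
    -- replacing `w` by the difference quotient `q` over the time `r / N` makes the sum telescope
    have hsum : ((N : 𝕜)⁻¹) • ∑ i ∈ Finset.range N, T (i * σ) q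
        = (((r : ℝ) : 𝕜)⁻¹) • (T r a - a) := by
      have h1 : ∀ i : ℕ, T (i * σ) q
          = (((σ : ℝ) : 𝕜)⁻¹) • (T ((i + 1 : ℕ) * σ) a - T (i * σ) a) := by
        intro i
        rw [Nat.cast_succ, add_mul, one_mul, hT.map_add, hq, map_smul, map_sub]; rfl
      simp only [h1]
      rw [← Finset.smul_sum, Finset.sum_range_sub (fun i : ℕ => T (i * σ) a), hNσ, smul_smul,
        Nat.cast_zero, zero_mul, hT.map_zero, ← mul_inv]
      congr 2
      rw [← hNσ]; push_cast; rfl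
    have h1 : P (((N : 𝕜)⁻¹) • ∑ i ∈ Finset.range N, (T (i * σ) w - T (i * σ) q) - 0) ≤ ε / 4 := by
      refine seminorm_average_sub_le P hN0 fun i hi => ?_
      rw [sub_zero, ← map_sub]
      refine (hE _ (hi1 i hi) _).trans ?_
      rw [map_sub_rev]
      exact hN.le
    have h2 : P ((((r : ℝ) : 𝕜)⁻¹) • (T r (x - a) - (x - a))) ≤ ε / 4 := by
      rw [← RCLike.ofReal_inv, seminorm_ofReal_smul P (by positivity), inv_mul_le_iff₀ hr0]
      have h3 := map_sub_le_add P (T r (x - a)) (x - a)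
      have h4 := hE r (by exact_mod_cast hr1'.le) (x - a)
      have h5 : P (x - a) ≤ Q (x - a) := hPQ _
      linarith
    have e : ((N : 𝕜)⁻¹) • ∑ i ∈ Finset.range N, T (i * σ) w - y
        = (((N : 𝕜)⁻¹) • ∑ i ∈ Finset.range N, (T (i * σ) w - T (i * σ) q) - 0)
          + (((((r : ℝ) : 𝕜)⁻¹) • (T r x - x) - y)
            - (((r : ℝ) : 𝕜)⁻¹) • (T r (x - a) - (x - a))) := by
      rw [Finset.sum_sub_distrib, smul_sub, hsum, map_sub]
      module
    rw [e]
    have h3 := map_add_le_add P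
      (((N : 𝕜)⁻¹) • ∑ i ∈ Finset.range N, (T (i * σ) w - T (i * σ) q) - 0)
      (((((r : ℝ) : 𝕜)⁻¹) • (T r x - x) - y) - (((r : ℝ) : 𝕜)⁻¹) • (T r (x - a) - (x - a)))
    have h4 := map_sub_le_add P ((((r : ℝ) : 𝕜)⁻¹) • (T r x - x) - y)
      ((((r : ℝ) : 𝕜)⁻¹) • (T r (x - a) - (x - a)))
    linarith

/-! ### The limit semigroup of a scheme -/

/-- In a complete space, a sequence that is eventually within `ε` of a fixed point, for every
`ε` and every continuous seminorm, converges. -/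
lemma exists_tendsto_of_forall_seminorm [UniformSpace X] [IsUniformAddGroup X] [CompleteSpace X]
    {p : SeminormFamily 𝕜 X ι} (hp : WithSeminorms p) {u : ℕ → X}
    (h : ∀ P : Seminorm 𝕜 X, Continuous P → ∀ ε > 0, ∃ y, ∀ᶠ n in atTop, P (u n - y) < ε) :
    ∃ x, Tendsto u atTop (𝓝 x) := by
  refine cauchy_map_iff_exists_tendsto.1 ((IsUniformAddGroup.cauchy_map_iff_tendsto _ _).2
    ⟨inferInstance, tendsto_of_forall_seminorm hp fun P hP ε hε => ?_⟩)
  obtain ⟨y, hy⟩ := h P hP (ε / 2) (by linarith)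
  filter_upwards [hy.prod_mk hy] with q hq
  have := map_sub_le_add P (u q.1 - y) (u q.2 - y)
  rw [sub_sub_sub_cancel_right] at this
  rw [sub_zero]
  linarith [hq.1, hq.2]

namespace IsStableScheme

variable [TopologicalSpace X] [IsTopologicalAddGroup X] {G : ℕ → X →L[𝕜] X} {h : ℕ → ℝ}

/-- The limit of `G n ^ m n` depends only on the limit of the elapsed time `m n * h n`. -/
lemma tendsto_pow_of_tendsto_pow {p : SeminormFamily 𝕜 X ι} (hp : WithSeminorms p)
    (H : IsStableScheme G h) {m m' : ℕ → ℕ} {s : ℝ}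
    (hm : Tendsto (fun n => m n * h n) atTop (𝓝 s))
    (hm' : Tendsto (fun n => m' n * h n) atTop (𝓝 s)) {L : Filter ℕ} (hL : L ≤ atTop) {x y : X}
    (hx : Tendsto (fun n => (G n ^ m n) x) L (𝓝 y)) :
    Tendsto (fun n => (G n ^ m' n) x) L (𝓝 y) := by
  refine tendsto_of_forall_seminorm hp fun P hP ε hε => ?_
  obtain ⟨Q, hQ, hPQ, hE⟩ := H.equi P hP (s + 1)
  obtain ⟨δ, hδ, h1⟩ := H.eventually_pow_sub_lt x hQ (show 0 < ε / 2 by linarith)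
  have hd : Tendsto (fun n => |(m n : ℝ) * h n - m' n * h n|) atTop (𝓝 0) := by
    simpa using (hm.sub hm').abs
  filter_upwards [eventually_seminorm_sub_lt hP hx (show 0 < ε / 2 by linarith), hL h1, hL hE,
    hL (hd.eventually_lt_const hδ), hL (hm.eventually_lt_const (show s < s + 1 by linarith)),
    hL (hm'.eventually_lt_const (show s < s + 1 by linarith))] with n hx h1 hE hd hm hm'
  have key : ∀ a b : ℕ, a ≤ b → a * h n ≤ s + 1 → b * h n - a * h n ≤ δ →
      P ((G n ^ b) x - (G n ^ a) x) ≤ ε / 2 := by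
    intro a b hab ha hb
    have e : (G n ^ b) x - (G n ^ a) x = (G n ^ a) ((G n ^ (b - a)) x - x) := by
      nth_rw 1 [← Nat.add_sub_of_le hab]
      rw [pow_add_apply, map_sub]
    rw [e]
    refine (hE a ha _).trans (h1 _ ?_).le
    rw [Nat.cast_sub hab]; linarith
  have h2 : P ((G n ^ m' n) x - (G n ^ m n) x) ≤ ε / 2 := by
    rcases le_total (m n) (m' n) with hle | hle
    · exact key _ _ hle hm.le (by linarith [neg_abs_le ((m n : ℝ) * h n - m' n * h n)])
    · rw [map_sub_rev]
      exact key _ _ hle hm'.le (by linarith [le_abs_self ((m n : ℝ) * h n - m' n * h n)])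
  have h3 := map_add_le_add P ((G n ^ m' n) x - (G n ^ m n) x) ((G n ^ m n) x - y)
  rw [sub_add_sub_cancel] at h3
  linarith

end IsStableScheme

/-- The operators `T s` are the limits of the powers of `G n` over the elapsed time `s`. -/
def IsSchemeLimit [TopologicalSpace X] (G : ℕ → X →L[𝕜] X) (h : ℕ → ℝ)
    (T : ℝ≥0 → X →L[𝕜] X) : Prop :=
  ∀ (s : ℝ≥0) (x : X) (μ : ℕ → ℕ), Tendsto (fun n => μ n * h n) atTop (𝓝 (s : ℝ)) →
    Tendsto (fun n => (G n ^ μ n) x) atTop (𝓝 (T s x))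

namespace IsStableScheme

section Existence

variable [UniformSpace X] [IsUniformAddGroup X] [CompleteSpace X]
  [T2Space X] {G : ℕ → X →L[𝕜] X} {h : ℕ → ℝ}

/-- Convergence of the powers on a dense set gives convergence everywhere. -/
theorem exists_isSchemeLimit {p : SeminormFamily 𝕜 X ι} (hp : WithSeminorms p)
    (H : IsStableScheme G h) {A : Set X} (hA : Dense A)
    (hconv : ∀ f ∈ A, ∀ s : ℝ≥0, ∃ y, ∀ μ : ℕ → ℕ,
      Tendsto (fun n => μ n * h n) atTop (𝓝 (s : ℝ)) →
        Tendsto (fun n => (G n ^ μ n) f) atTop (𝓝 y)) :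
    ∃ T : ℝ≥0 → X →L[𝕜] X, IsSchemeLimit G h T := by
  have hcs := hp.continuousSMul
  have hex : ∀ (s : ℝ≥0) (x : X), ∃ y, ∀ μ : ℕ → ℕ,
      Tendsto (fun n => μ n * h n) atTop (𝓝 (s : ℝ)) →
        Tendsto (fun n => (G n ^ μ n) x) atTop (𝓝 y) := by
    intro s x
    have hμ : Tendsto (fun n => (⌊(s : ℝ) / h n⌋₊ : ℝ) * h n) atTop (𝓝 (s : ℝ)) :=
      H.tendsto_floor_mul s.2
    obtain ⟨y, hy⟩ : ∃ y, Tendsto (fun n => (G n ^ ⌊(s : ℝ) / h n⌋₊) x) atTop (𝓝 y) := by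
      refine exists_tendsto_of_forall_seminorm hp fun P hP ε hε => ?_
      obtain ⟨Q, hQ, hPQ, hE⟩ := H.equi P hP (s + 1)
      obtain ⟨f, hf, hxf⟩ := exists_mem_seminorm_sub_lt hA hQ x (show 0 < ε / 2 by linarith)
      obtain ⟨y, hy⟩ := hconv f hf s
      refine ⟨y, ?_⟩
      filter_upwards [hE, hμ.eventually_lt_const (lt_add_one (s : ℝ)),
        eventually_seminorm_sub_lt hP (hy _ hμ) (show 0 < ε / 2 by linarith)] with n hE hs hn
      have h1 := map_add_le_add P ((G n ^ ⌊(s : ℝ) / h n⌋₊) (x - f))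
        ((G n ^ ⌊(s : ℝ) / h n⌋₊) f - y)
      rw [map_sub, sub_add_sub_cancel, ← map_sub] at h1
      have h2 := hE _ hs.le (x - f)
      linarith
    exact ⟨y, fun μ hμ' => H.tendsto_pow_of_tendsto_pow hp hμ hμ' le_rfl hy⟩
  choose T hT using hex
  have hfl : ∀ s : ℝ≥0, Tendsto (fun n => (⌊(s : ℝ) / h n⌋₊ : ℝ) * h n) atTop (𝓝 (s : ℝ)) :=
    fun s => H.tendsto_floor_mul s.2
  have hadd : ∀ s x y, T s (x + y) = T s x + T s y := fun s x y => by
    refine tendsto_nhds_unique (hT s (x + y) _ (hfl s)) ?_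
    simpa only [map_add] using (hT s x _ (hfl s)).add (hT s y _ (hfl s))
  have hsmul : ∀ s (c : 𝕜) x, T s (c • x) = c • T s x := fun s c x => by
    refine tendsto_nhds_unique (hT s (c • x) _ (hfl s)) ?_
    simpa only [map_smul] using (hT s x _ (hfl s)).const_smul c
  let T' : ℝ≥0 → X →ₗ[𝕜] X := fun s => ⟨⟨T s, hadd s⟩, hsmul s⟩
  have hcont : ∀ s, Continuous (T' s) := fun s => by
    refine continuous_of_continuousAt_zero (T' s) ?_
    refine tendsto_of_forall_seminorm hp fun P hP ε hε => ?_
    obtain ⟨Q, hQ, hPQ, hE⟩ := H.equi P hP (s + 1)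
    filter_upwards [eventually_seminorm_sub_lt hQ tendsto_id hε] with x hx
    rw [map_zero, sub_zero]
    refine lt_of_le_of_lt ?_ (show Q x < ε by simpa using hx)
    refine le_of_tendsto ((hP.tendsto _).comp (hT s x _ (hfl s))) ?_
    filter_upwards [hE, (hfl s).eventually_lt_const (lt_add_one (s : ℝ))] with n hn hs
    exact hn _ hs.le x
  exact ⟨fun s => ⟨T' s, hcont s⟩, hT⟩

end Existence

variable [TopologicalSpace X] [IsTopologicalAddGroup X]
  {G : ℕ → X →L[𝕜] X} {h : ℕ → ℝ} {T : ℝ≥0 → X →L[𝕜] X}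

lemma tendsto_quotient_of_isSchemeLimit {p : SeminormFamily 𝕜 X ι} (hp : WithSeminorms p)
    (H : IsStableScheme G h) (hT : IsSchemeLimit G h T) {g z : X}
    (hgz : (g, z) ∈ closure (limGraph G h)) :
    Tendsto (fun r : ℝ≥0 => (((r : ℝ) : 𝕜)⁻¹) • (T r g - g)) (𝓝[>] 0) (𝓝 z) := by
  refine tendsto_of_forall_seminorm hp fun P hP ε hε => ?_
  have := hp.continuousSMul
  obtain ⟨δ, hδ, h1⟩ := H.eventually_quotient_sub_lt hgz hP (show 0 < ε / 2 by linarith)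
  have hsmall : ∀ᶠ r : ℝ≥0 in 𝓝[>] 0, (r : ℝ) < δ :=
    Filter.Eventually.filter_mono nhdsWithin_le_nhds
      ((NNReal.continuous_coe.tendsto 0).eventually_lt_const (by simpa using hδ))
  filter_upwards [hsmall, self_mem_nhdsWithin] with r hr hr0
  refine lt_of_le_of_lt (b := ε / 2) ?_ (by linarith)
  have hfl := H.tendsto_floor_mul r.2
  refine le_of_tendsto ((hP.tendsto _).comp
    ((((hT r g _ hfl).sub_const g).const_smul (((r : ℝ) : 𝕜)⁻¹)).sub_const z)) ?_
  filter_upwards [h1 r hr0 hr.le _ hfl] with n hn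
  exact hn.le

variable [T2Space X]

theorem isLC0Semigroup_of_isSchemeLimit {p : SeminormFamily 𝕜 X ι} (hp : WithSeminorms p)
    (H : IsStableScheme G h) (hT : IsSchemeLimit G h T) : IsLC0Semigroup p T := by
  have hfl : ∀ s : ℝ≥0, Tendsto (fun n => (⌊(s : ℝ) / h n⌋₊ : ℝ) * h n) atTop (𝓝 (s : ℝ)) :=
    fun s => H.tendsto_floor_mul s.2
  refine isLC0Semigroup_of_exists_seminorm hp ?_ ?_ ?_ ?_
  · ext x
    refine tendsto_nhds_unique (hT 0 x (fun _ => 0) (by simp)) ?_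
    simp
  · intro l m
    ext x
    have hlm : Tendsto (fun n => ((⌊(l : ℝ) / h n⌋₊ + ⌊(m : ℝ) / h n⌋₊ : ℕ) : ℝ) * h n) atTop
        (𝓝 ((l + m : ℝ≥0) : ℝ)) := by
      refine ((hfl l).add (hfl m)).congr fun n => ?_
      push_cast; ring
    refine tendsto_nhds_unique (hT (l + m) x _ hlm) ?_
    refine tendsto_of_forall_seminorm hp fun P hP ε hε => ?_
    obtain ⟨Q, hQ, hPQ, hE⟩ := H.equi P hP (l + 1)
    filter_upwards [hE, (hfl l).eventually_lt_const (lt_add_one (l : ℝ)),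
      eventually_seminorm_sub_lt hP (hT l (T m x) _ (hfl l)) (show 0 < ε / 2 by linarith),
      eventually_seminorm_sub_lt hQ (hT m x _ (hfl m)) (show 0 < ε / 2 by linarith)]
      with n hE hl h1 h2
    have h3 := map_add_le_add P
      ((G n ^ ⌊(l : ℝ) / h n⌋₊) ((G n ^ ⌊(m : ℝ) / h n⌋₊) x - T m x))
      ((G n ^ ⌊(l : ℝ) / h n⌋₊) (T m x) - T l (T m x))
    rw [map_sub, sub_add_sub_cancel, ← map_sub] at h3
    have h4 := hE _ hl.le ((G n ^ ⌊(m : ℝ) / h n⌋₊) x - T m x)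
    rw [pow_add_apply, ContinuousLinearMap.comp_apply]
    linarith
  · intro P hP S
    obtain ⟨Q, hQ, hPQ, hE⟩ := H.equi P hP (S + 1)
    refine ⟨Q, hQ, fun s hs x => le_of_tendsto ((hP.tendsto _).comp (hT s x _ (hfl s))) ?_⟩
    have hs' : (s : ℝ) < S + 1 := lt_of_le_of_lt (by exact_mod_cast hs) (lt_add_one (S : ℝ))
    filter_upwards [hE, (hfl s).eventually_lt_const hs'] with n hn hs
    exact hn _ hs.le x
  · intro x P hP ε hε
    obtain ⟨δ, hδ, h1⟩ := H.eventually_pow_sub_lt x hP (show 0 < ε / 2 by linarith)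
    refine ⟨δ / 2, by positivity, fun s hs => ?_⟩
    refine lt_of_le_of_lt (b := ε / 2) ?_ (by linarith)
    refine le_of_tendsto ((hP.tendsto _).comp ((hT s x _ (hfl s)).sub_const x)) ?_
    filter_upwards [h1, (hfl s).eventually_lt_const (show (s : ℝ) < δ by linarith)] with n hn hs
    exact (hn _ hs.le).le

/-- A closed subspace `Γ` of pairs of derivatives is the graph of the generator of the limit
semigroup as soon as it contains the orbits of a dense set of its first components. -/
theorem mem_iff_tendsto_quotient {p : SeminormFamily 𝕜 X ι} (hp : WithSeminorms p)
    (H : IsStableScheme G h) (hT : IsSchemeLimit G h T) {Γ : Submodule 𝕜 (X × X)}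
    (hΓ : IsClosed (Γ : Set (X × X))) (hΓG : (Γ : Set (X × X)) ⊆ closure (limGraph G h))
    {A : Set X} (hA : Dense A)
    (hAΓ : ∀ a ∈ A, (∃ w, (a, w) ∈ Γ) ∧ ∀ s : ℝ≥0, ∃ z, (T s a, z) ∈ Γ) (x y : X) :
    (x, y) ∈ Γ ↔
      Tendsto (fun r : ℝ≥0 => (((r : ℝ) : 𝕜)⁻¹) • (T r x - x)) (𝓝[>] 0) (𝓝 y) := by
  refine ⟨fun hxy => H.tendsto_quotient_of_isSchemeLimit hp hT (hΓG hxy), fun hxy => ?_⟩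
  rw [← SetLike.mem_coe, ← hΓ.closure_eq]
  refine mem_closure_of_tendsto_quotient hp (H.isLC0Semigroup_of_isSchemeLimit hp hT) hA
    (fun a ha => ?_) hxy
  obtain ⟨⟨w, hw⟩, hs⟩ := hAΓ a ha
  refine ⟨w, fun s => ?_, H.tendsto_quotient_of_isSchemeLimit hp hT (hΓG hw)⟩
  obtain ⟨z, hz⟩ := hs s
  have hfl := H.tendsto_floor_mul s.2
  have h1 := H.tendsto_pow_derivative hp (hΓG hw) (hΓG hz) le_rfl s.2 hfl (hT s a _ hfl)
  rwa [tendsto_nhds_unique (hT s w _ hfl) h1]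

end IsStableScheme

/-- Chernoff's theorem on the domain of the generator: if the derivative of the scheme extends the
generator of `T`, then the scheme converges to `T`. -/
theorem IsLC0Semigroup.tendsto_pow [TopologicalSpace X] [IsTopologicalAddGroup X]
    {p : SeminormFamily 𝕜 X ι} (hp : WithSeminorms p) {T : ℝ≥0 → X →L[𝕜] X}
    (hT : IsLC0Semigroup p T) {G : ℕ → X →L[𝕜] X} {h : ℕ → ℝ} (H : IsStableScheme G h) {f w : X}
    (hfw : Tendsto (fun r : ℝ≥0 => (((r : ℝ) : 𝕜)⁻¹) • (T r f - f)) (𝓝[>] 0) (𝓝 w))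
    (hG : ∀ s, (T s f, T s w) ∈ closure (limGraph G h)) (s : ℝ≥0) {μ : ℕ → ℕ}
    (hμ : Tendsto (fun n => μ n * h n) atTop (𝓝 (s : ℝ))) :
    Tendsto (fun n => (G n ^ μ n) f) atTop (𝓝 (T s f)) := by
  have key := H.tendsto_pow_of_smooth hp s.2 (y := fun r => T r.toNNReal f)
    (z := fun r => T r.toNNReal w) (fun r _ => hG _) ?_ hμ
  · simpa [hT.map_zero] using key
  intro R hR η hη
  obtain ⟨Q, hQ, hRQ, hE⟩ := hT.exists_seminorm hp hR s
  have hw : Tendsto (fun r : ℝ≥0 => T r w) (𝓝[>] 0) (𝓝 w) := by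
    have h1 := (hT.continuous w).tendsto 0
    rw [hT.map_zero] at h1
    exact h1.mono_left nhdsWithin_le_nhds
  have hev := (eventually_seminorm_sub_lt hQ hfw (half_pos hη)).and
    (eventually_seminorm_sub_lt hQ hw (half_pos hη))
  obtain ⟨δ₀, hδ₀, hsub⟩ := Metric.mem_nhdsWithin_iff.1 hev
  refine ⟨δ₀ / 2, by positivity, fun δ hδ hδδ₀ r hr hrs => ?_⟩
  have hrs' : r.toNNReal ≤ s := by rwa [Real.toNNReal_le_iff_le_coe]
  have hsum : ∀ x, T (r + δ).toNNReal x = T r.toNNReal (T δ.toNNReal x) := fun x => by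
    rw [Real.toNNReal_add hr hδ.le, hT.map_add]; rfl
  obtain ⟨h1, h2⟩ := hsub (⟨by
    rw [Metric.mem_ball, NNReal.dist_eq, Real.coe_toNNReal _ hδ.le, NNReal.coe_zero, sub_zero,
      abs_of_pos hδ]
    linarith, by simpa using hδ⟩ : δ.toNNReal ∈ Metric.ball (0 : ℝ≥0) δ₀ ∩ Set.Ioi 0)
  rw [Real.coe_toNNReal _ hδ.le] at h1
  refine ⟨?_, ?_⟩
  · simp only [hsum]
    rw [← map_sub, ← map_smul, ← map_sub]
    refine (hE _ hrs' _).trans ?_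
    rw [map_sub_rev]
    linarith
  · simp only [hsum]
    rw [← map_sub, ← map_smul, ← map_sub]
    refine (hE _ hrs' _).trans ?_
    have h3 := map_sub_le_add Q (T δ.toNNReal w - w)
      (((δ : 𝕜)⁻¹) • (T δ.toNNReal f - f) - w)
    rw [sub_sub_sub_cancel_right] at h3
    linarith

/-! ### Weak limits -/

lemma tendsto_apply_of_tendsto_toWeakSpace [TopologicalSpace X] {β : Type*}
    {l : Filter β} {v : β → X} {y : X}
    (h : Tendsto (fun k => toWeakSpace 𝕜 X (v k)) l (𝓝 (toWeakSpace 𝕜 X y)))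
    (φ : X →L[𝕜] 𝕜) : Tendsto (fun k => φ (v k)) l (𝓝 (φ y)) :=
  ((WeakBilin.eval_continuous (topDualPairing 𝕜 X).flip φ).tendsto _).comp h

/-- A closed subspace of `X × X` is weakly sequentially closed. -/
lemma mem_of_tendsto_toWeakSpace [TopologicalSpace X] {p : SeminormFamily 𝕜 X ι}
    (hp : WithSeminorms p) {Γ : Submodule 𝕜 (X × X)} (hΓ : IsClosed (Γ : Set (X × X)))
    {β : Type*} {l : Filter β} [l.NeBot] {u v : β → X} {y z : X} (huv : ∀ k, (u k, v k) ∈ Γ)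
    (hu : Tendsto (fun k => toWeakSpace 𝕜 X (u k)) l (𝓝 (toWeakSpace 𝕜 X y)))
    (hv : Tendsto (fun k => toWeakSpace 𝕜 X (v k)) l (𝓝 (toWeakSpace 𝕜 X z))) :
    (y, z) ∈ Γ := by
  have := hp.topologicalAddGroup
  have := hp.continuousSMul
  let _ : Module ℝ X := Module.compHom X (algebraMap ℝ 𝕜)
  have : IsScalarTower ℝ 𝕜 X := ⟨fun r c x => by
    rw [Algebra.smul_def, mul_smul]; rfl⟩
  have : LocallyConvexSpace ℝ X := hp.toLocallyConvexSpace
  by_contra hyz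
  obtain ⟨φ, c, hφ, hc⟩ := RCLike.geometric_hahn_banach_closed_point (𝕜 := 𝕜)
    (s := (Γ : Set (X × X))) ((Γ.restrictScalars ℝ).convex) hΓ hyz
  have e : ∀ a b : X, φ (a, b) = (φ.comp (ContinuousLinearMap.inl 𝕜 X X)) a
      + (φ.comp (ContinuousLinearMap.inr 𝕜 X X)) b := by
    intro a b
    simp [← map_add]
  have hlim : Tendsto (fun k => RCLike.re (φ (u k, v k))) l (𝓝 (RCLike.re (φ (y, z)))) := by
    simp only [e]
    exact (RCLike.continuous_re.tendsto _).comp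
      ((tendsto_apply_of_tendsto_toWeakSpace hu _).add (tendsto_apply_of_tendsto_toWeakSpace hv _))
  have := le_of_tendsto hlim (Eventually.of_forall fun k => (hφ _ (huv k)).le)
  linarith

/-! ### Functions of class `𝓕_X` -/

/-- The `⌊n s⌋` steps of length `t / n` take the time `s t` in the limit. -/
lemma tendsto_floor_mul_div {t : ℝ≥0} (ht : 0 < t) (s : ℝ≥0) :
    Tendsto (fun n : ℕ => (⌊(n : ℝ≥0) * s⌋₊ : ℝ) * ((t / (n : ℝ≥0) : ℝ≥0) : ℝ)) atTop
      (𝓝 ((s * t : ℝ≥0) : ℝ)) := by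
  have h1 : Tendsto (fun n : ℕ => ((t / (n : ℝ≥0) : ℝ≥0) : ℝ)) atTop (𝓝 0) :=
    (NNReal.continuous_coe.tendsto 0).comp
      ((tendsto_div_nat ht).mono_right nhdsWithin_le_nhds)
  have h2 : Tendsto (fun n : ℕ => ((s * t : ℝ≥0) : ℝ) - ((t / (n : ℝ≥0) : ℝ≥0) : ℝ)) atTop
      (𝓝 ((s * t : ℝ≥0) : ℝ)) := by
    simpa using h1.const_sub ((s * t : ℝ≥0) : ℝ)
  have e : ∀ n : ℕ, 0 < n → ((n : ℝ) * s) * ((t / (n : ℝ≥0) : ℝ≥0) : ℝ) = (s * t : ℝ≥0) := by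
    intro n hn
    have : (n : ℝ) ≠ 0 := by exact_mod_cast hn.ne'
    push_cast
    field_simp
  have hfloor : ∀ n : ℕ, (⌊(n : ℝ≥0) * s⌋₊ : ℝ) ≤ n * s := fun n => by
    exact_mod_cast Nat.floor_le (zero_le : (0 : ℝ≥0) ≤ (n : ℝ≥0) * s)
  have hfloor' : ∀ n : ℕ, (n : ℝ) * s ≤ ⌊(n : ℝ≥0) * s⌋₊ + 1 := fun n => by
    exact_mod_cast (Nat.lt_floor_add_one ((n : ℝ≥0) * s)).le
  refine tendsto_of_tendsto_of_tendsto_of_le_of_le' h2 tendsto_const_nhds ?_ ?_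
  · filter_upwards [eventually_gt_atTop 0] with n hn
    rw [← e n hn]
    have := mul_le_mul_of_nonneg_right (hfloor' n) (t / (n : ℝ≥0) : ℝ≥0).2
    change (n : ℝ) * s * ((t / (n : ℝ≥0) : ℝ≥0) : ℝ)
      ≤ (⌊(n : ℝ≥0) * s⌋₊ + 1) * ((t / (n : ℝ≥0) : ℝ≥0) : ℝ) at this
    linarith
  · filter_upwards [eventually_gt_atTop 0] with n hn
    rw [← e n hn]
    exact mul_le_mul_of_nonneg_right (hfloor n) (t / (n : ℝ≥0) : ℝ≥0).2

lemma mem_limGraph_of_mem_multiEffDeriv [TopologicalSpace X] {F : ℝ≥0 → X →L[𝕜] X}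
    (hF0 : F 0 = ContinuousLinearMap.id 𝕜 X) {t : ℝ≥0} (ht : 0 < t) {g z : X}
    (hz : z ∈ multiEffDeriv F g) :
    (g, z) ∈ limGraph (fun n : ℕ => F (t / (n : ℝ≥0)))
      (fun n : ℕ => ((t / (n : ℝ≥0) : ℝ≥0) : ℝ)) := by
  obtain ⟨u, hu, hB⟩ := hz
  have hd := tendsto_div_nat ht
  refine ⟨_, _, hu.comp hd, hB.comp hd, ?_⟩
  filter_upwards [hd.eventually self_mem_nhdsWithin] with n hn
  have hn0 : (((t / (n : ℝ≥0) : ℝ≥0) : ℝ) : 𝕜) ≠ 0 := by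
    have : (t / (n : ℝ≥0) : ℝ≥0) ≠ 0 := ne_of_gt hn
    exact_mod_cast this
  simp only [Function.comp_apply]
  rw [smul_smul, mul_inv_cancel₀ hn0, one_smul, hF0]
  simp

lemma ClassF.isStableScheme [TopologicalSpace X] [IsTopologicalAddGroup X]
    {p : SeminormFamily 𝕜 X ι} (hp : WithSeminorms p) {F : ℝ≥0 → X →L[𝕜] X} (hF : ClassF p F)
    {t : ℝ≥0} (ht : 0 < t) :
    IsStableScheme (fun n : ℕ => F (t / (n : ℝ≥0)))
      (fun n : ℕ => ((t / (n : ℝ≥0) : ℝ≥0) : ℝ)) where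
  pos := (tendsto_div_nat ht).eventually self_mem_nhdsWithin
  tendsto_zero := (NNReal.continuous_coe.tendsto 0).comp
    ((tendsto_div_nat ht).mono_right nhdsWithin_le_nhds)
  equi P hP S := by
    obtain ⟨Q, hQ, h⟩ := (hF.1.2 S.toNNReal).exists_seminorm hp hP
    refine ⟨P ⊔ Q, hP.max hQ, le_sup_left, ?_⟩
    filter_upwards [eventually_ge_atTop 1] with n hn m hm x
    rcases Nat.eq_zero_or_pos m with rfl | hm0
    · simp
    · have hmem : F (t / (n : ℝ≥0)) ^ m ∈ iterates F S.toNNReal := by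
        refine ⟨t, n, m, hn, hm0, ?_, rfl⟩
        rw [mul_div_assoc]
        exact NNReal.le_toNNReal_of_coe_le (by exact_mod_cast hm)
      exact (h _ hmem x).trans (le_max_right (P x) (Q x))
  dense := hF.2.mono fun _ hf => hf.imp fun _ hz =>
    mem_limGraph_of_mem_multiEffDeriv hF.1.1 ht hz

/-! ### Extraction of convergent subsequences -/

lemma map_atTop_le_of_strictMono {φ : ℕ → ℕ} (hφ : StrictMono φ) : map φ atTop ≤ atTop :=
  hφ.tendsto_atTop

/-- Finitely many properties, each of which passes to subsequences and can be achieved by passing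
to a subsequence, hold simultaneously along some subsequence. -/
lemma exists_strictMono_forall_lt {C : ℕ → (ℕ → ℕ) → Prop}
    (hC : ∀ (i : ℕ) (φ ψ : ℕ → ℕ), C i φ → StrictMono ψ → C i (φ ∘ ψ))
    (hex : ∀ (i : ℕ) (φ : ℕ → ℕ), StrictMono φ → ∃ ψ : ℕ → ℕ, StrictMono ψ ∧ C i (φ ∘ ψ)) (M : ℕ) :
    ∃ φ : ℕ → ℕ, StrictMono φ ∧ ∀ i < M, C i φ := by
  induction M with
  | zero => exact ⟨id, strictMono_id, by simp⟩
  | succ M ih =>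
    obtain ⟨φ, hφ, h⟩ := ih
    obtain ⟨ψ, hψ, h'⟩ := hex M φ hφ
    refine ⟨φ ∘ ψ, hφ.comp hψ, fun i hi => ?_⟩
    rcases Nat.lt_succ_iff_lt_or_eq.1 hi with hi | rfl
    · exact hC i φ ψ (h i hi) hψ
    · exact h'

/-- If at every time each subsequence of the scheme started at `f` has a sub-subsequence whose
limit `y` has a derivative in `Γ`, then the whole sequence converges, with the same property of the
limit. -/
lemma IsStableScheme.exists_tendsto_pow [UniformSpace X] [IsUniformAddGroup X] [CompleteSpace X]
    [T2Space X] {p : SeminormFamily 𝕜 X ι} (hp : WithSeminorms p) {G : ℕ → X →L[𝕜] X} {h : ℕ → ℝ}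
    (H : IsStableScheme G h) {Γ : Set (X × X)} (hΓ : Γ ⊆ closure (limGraph G h)) {f w : X}
    (hf : (f, w) ∈ Γ)
    (hcpt : ∀ (τ : ℝ≥0) (a : ℕ → ℕ), StrictMono a → ∃ b : ℕ → ℕ, StrictMono b ∧ ∃ y z,
      (y, z) ∈ Γ ∧ ∀ μ : ℕ → ℕ, Tendsto (fun n => μ n * h n) atTop (𝓝 (τ : ℝ)) →
        Tendsto (fun n => (G n ^ μ n) f) (map (a ∘ b) atTop) (𝓝 y)) (s : ℝ≥0) :
    ∃ y, (∃ z, (y, z) ∈ Γ) ∧ ∀ μ : ℕ → ℕ, Tendsto (fun n => μ n * h n) atTop (𝓝 (s : ℝ)) →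
      Tendsto (fun n => (G n ^ μ n) f) atTop (𝓝 y) := by
  have hfl : Tendsto (fun n => (⌊(s : ℝ) / h n⌋₊ : ℝ) * h n) atTop (𝓝 (s : ℝ)) :=
    H.tendsto_floor_mul s.2
  -- it suffices to have convergence for one choice of the numbers of steps
  suffices hconv : ∃ y, Tendsto (fun n => (G n ^ ⌊(s : ℝ) / h n⌋₊) f) atTop (𝓝 y) by
    obtain ⟨y, hy⟩ := hconv
    refine ⟨y, ?_, fun μ hμ => H.tendsto_pow_of_tendsto_pow hp hfl hμ le_rfl hy⟩
    obtain ⟨b, hb, y', z, hyz, hlim⟩ := hcpt s id strictMono_id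
    have : y' = y := tendsto_nhds_unique (hlim _ hfl)
      (hy.mono_left (map_atTop_le_of_strictMono (strictMono_id.comp hb)))
    exact ⟨z, this ▸ hyz⟩
  rcases eq_or_lt_of_le (NNReal.coe_nonneg s) with hs | hs
  · refine ⟨f, ?_⟩
    simp [← hs]
  refine exists_tendsto_of_forall_seminorm hp fun P hP ε hε => ?_
  obtain ⟨δ₀, hδ₀, key⟩ := H.eventually_pow_sub_limit_lt hp (hΓ hf) hs hP hε
  obtain ⟨M, hM⟩ := exists_nat_gt ((s : ℝ) / δ₀)
  have hMR : (0 : ℝ) < M := lt_of_le_of_lt (by positivity) hM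
  have hM0 : 0 < M := by exact_mod_cast hMR
  have hMδ : (s : ℝ) / M ≤ δ₀ := by
    rw [div_le_iff₀ hMR]
    rw [div_lt_iff₀ hδ₀] at hM
    linarith
  obtain ⟨φ, hφ, hφlim⟩ := exists_strictMono_forall_lt
    (C := fun i φ => ∃ y z, (y, z) ∈ Γ ∧ ∀ μ : ℕ → ℕ,
      Tendsto (fun n => μ n * h n) atTop (𝓝 (((i : ℝ≥0) * (s / M) : ℝ≥0) : ℝ)) →
        Tendsto (fun n => (G n ^ μ n) f) (map φ atTop) (𝓝 y))
    (fun i φ ψ hi hψ => by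
      obtain ⟨y, z, hyz, hlim⟩ := hi
      refine ⟨y, z, hyz, fun μ hμ => (hlim μ hμ).mono_left ?_⟩
      rw [← map_map]
      exact map_mono (map_atTop_le_of_strictMono hψ))
    (fun i φ hφ => hcpt _ φ hφ) (M + 1)
  choose! y z hyz hlim using hφlim
  refine ⟨y M, key M hM0 hMδ (map φ atTop) inferInstance (map_atTop_le_of_strictMono hφ) y z
    (fun i hi => hΓ (hyz i (by omega))) (fun i hi => hlim i (by omega) _ ?_) _ hfl⟩
  have := (H.tendsto_floor_mul (div_nonneg hs.le hMR.le)).const_mul (i : ℝ)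
  push_cast
  refine this.congr fun n => ?_
  ring

end LocallyConvexChernoff

open LocallyConvexChernoff in
theorem theorem8p3 {𝕜 X ι : Type*} [RCLike 𝕜] [AddCommGroup X] [Module 𝕜 X]
    [UniformSpace X] [IsUniformAddGroup X] [ContinuousSMul 𝕜 X] [T2Space X] [CompleteSpace X]
    (p : SeminormFamily 𝕜 X ι) (hp : WithSeminorms p)
    (Z : X →ₗ.[𝕜] X) (hZ : Dense (Z.domain : Set X))
    (t : ℝ≥0) (ht : 0 < t)
    (F : ℝ≥0 → X →L[𝕜] X) (hF : LocallyConvexChernoff.ClassF p F)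
    (hFZ : ∀ g : Z.domain, Z g ∈ LocallyConvexChernoff.multiEffDeriv F (g : X)) :
    (Z.IsClosable ∧ LocallyConvexChernoff.GeneratesLC0Semigroup p Z.closure) ↔
      ∃ A : Submodule 𝕜 X, A ≤ Z.domain ∧ Dense (A : Set X) ∧
        ∀ f ∈ A, ∀ s : ℝ≥0, ∃ u : ℕ → Z.closure.domain,
          Tendsto
            (fun n : ℕ =>
              toWeakSpace 𝕜 X ((F (t / (n : ℝ≥0)) ^ ⌊(n : ℝ≥0) * s⌋₊) f - (u n : X)))
            atTop (𝓝 0) ∧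
          LocallyConvexChernoff.SubseqRelCompact
            (fun n : ℕ => (F (t / (n : ℝ≥0)) ^ ⌊(n : ℝ≥0) * s / t⌋₊) f) ∧
          LocallyConvexChernoff.SubseqRelCompact
            (fun n : ℕ => toWeakSpace 𝕜 X (Z.closure (u n))) := by
  have H := hF.isStableScheme hp ht
  set G : ℕ → X →L[𝕜] X := fun n => F (t / (n : ℝ≥0)) with hGdef
  set h : ℕ → ℝ := fun n => ((t / (n : ℝ≥0) : ℝ≥0) : ℝ) with hhdef
  have hZG : (Z.graph : Set (X × X)) ⊆ limGraph G h := by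
    rintro ⟨g, z⟩ hgz
    obtain ⟨g', rfl, rfl⟩ := (LinearPMap.mem_graph_iff _).1 hgz
    exact mem_limGraph_of_mem_multiEffDeriv hF.1.1 ht (hFZ g')
  -- single-valuedness of the closure of the approximate derivative makes `Z` closable
  have hclos : Z.IsClosable := by
    refine ⟨Z.graph.topologicalClosure.toLinearPMap, (Submodule.toLinearPMap_graph_eq _ ?_).symm⟩
    rintro ⟨g, z⟩ hgz hg
    obtain rfl : g = 0 := hg
    exact H.eq_zero_of_mem_closure hp (closure_mono hZG hgz)
  have hgraph : (Z.closure.graph : Set (X × X)) = closure (Z.graph : Set (X × X)) := by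
    rw [← hclos.graph_closure_eq_closure_graph]; rfl
  have hΓ : IsClosed (Z.closure.graph : Set (X × X)) := by
    rw [hgraph]; exact isClosed_closure
  have hΓG : (Z.closure.graph : Set (X × X)) ⊆ closure (limGraph G h) := by
    rw [hgraph]; exact closure_mono hZG
  have hdom : ∀ f ∈ Z.domain, ∃ w, (f, w) ∈ Z.closure.graph := fun f hf =>
    ⟨Z ⟨f, hf⟩, LinearPMap.le_graph_of_le Z.le_closure (Z.mem_graph ⟨f, hf⟩)⟩
  have htime : ∀ s : ℝ≥0, Tendsto (fun n : ℕ => (⌊(n : ℝ≥0) * s / t⌋₊ : ℝ) * h n) atTop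
      (𝓝 (s : ℝ)) := fun s => by
    have := tendsto_floor_mul_div ht (s / t)
    rw [div_mul_cancel₀ s ht.ne'] at this
    simpa only [mul_div_assoc] using this
  constructor
  -- a generator: `A = Z.domain` and the constant sequence `u n = T (s * t) f`
  · rintro ⟨-, T, hT, hgen⟩
    simp only [IsDerivAtZero, hT.map_zero, ContinuousLinearMap.id_apply] at hgen
    refine ⟨Z.domain, le_rfl, hZ, fun f hf s => ?_⟩
    obtain ⟨w, hw⟩ := hdom f hf
    have hfw := (hgen f w).1 hw
    have horb : ∀ r, (T r f, T r w) ∈ Z.closure.graph := fun r => by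
      refine (hgen _ _).2 ?_
      have h1 := ((T r).continuous.tendsto w).comp hfw
      refine h1.congr fun a => ?_
      have hc : T r (T a f) = T a (T r f) := by
        rw [← ContinuousLinearMap.comp_apply, ← hT.map_add, add_comm, hT.map_add]; rfl
      simp only [Function.comp_apply, map_smul, map_sub, hc]
    have hconv := fun r μ hμ => hT.tendsto_pow hp H hfw (fun r => hΓG (horb r)) r (μ := μ) hμ
    obtain ⟨u, hu, -⟩ := (LinearPMap.mem_graph_iff _).1 (horb (s * t))
    refine ⟨fun _ => u, ?_, ?_, ?_⟩
    · have h1 := (hconv (s * t) _ (tendsto_floor_mul_div ht s)).sub_const (u : X)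
      rw [hu, sub_self] at h1
      have h2 := ((toWeakSpaceCLM 𝕜 X).continuous.tendsto 0).comp h1
      rw [map_zero, ← hu] at h2
      exact h2
    · intro a ha
      exact ⟨id, strictMono_id, T s f, (hconv s _ (htime s)).comp ha.tendsto_atTop⟩
    · intro a _
      exact ⟨id, strictMono_id, _, tendsto_const_nhds⟩
  · rintro ⟨A, hAZ, hA, hAu⟩
    refine ⟨hclos, ?_⟩
    have hcpt : ∀ f ∈ A, ∀ s : ℝ≥0, ∃ y, (∃ z, (y, z) ∈ (Z.closure.graph : Set (X × X))) ∧
        ∀ μ : ℕ → ℕ, Tendsto (fun n => μ n * h n) atTop (𝓝 (s : ℝ)) →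
          Tendsto (fun n => (G n ^ μ n) f) atTop (𝓝 y) := by
      intro f hf
      obtain ⟨w, hw⟩ := hdom f (hAZ hf)
      refine H.exists_tendsto_pow hp hΓG hw fun τ a ha => ?_
      -- the two weak conditions at `τ / t` concern the same numbers of steps as the strong one at `τ`
      obtain ⟨u, hua, -, huc⟩ := hAu f hf (τ / t)
      obtain ⟨-, -, hub, -⟩ := hAu f hf τ
      obtain ⟨b, hb, y, hy⟩ := hub a ha
      obtain ⟨c, hc, z, hz⟩ := huc (a ∘ b) (ha.comp hb)
      have hy' : Tendsto (fun k => (G (a (b (c k))) ^ ⌊((a (b (c k)) : ℕ) : ℝ≥0) * τ / t⌋₊) f)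
          atTop (𝓝 y) := hy.comp hc.tendsto_atTop
      refine ⟨b ∘ c, hb.comp hc, y, (toWeakSpace 𝕜 X).symm z, ?_, fun μ hμ => ?_⟩
      -- the strong limit `y` of the scheme is the weak limit of `u`
      · refine mem_of_tendsto_toWeakSpace hp hΓ (l := atTop)
          (u := fun k => (u (a (b (c k))) : X)) (v := fun k => Z.closure (u (a (b (c k)))))
          (fun k => Z.closure.mem_graph _) ?_ (by simpa using hz)
        have h1 := ((toWeakSpaceCLM 𝕜 X).continuous.tendsto y).comp hy'
        have h2 := hua.comp ((ha.comp (hb.comp hc)).tendsto_atTop)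
        have h3 := h1.sub h2
        rw [sub_zero] at h3
        refine h3.congr fun k => ?_
        simp only [Function.comp_apply, toWeakSpaceCLM_eq_toWeakSpace, map_sub, mul_div_assoc,
          hGdef]
        abel
      · refine H.tendsto_pow_of_tendsto_pow hp (htime τ) hμ
          (map_atTop_le_of_strictMono (ha.comp (hb.comp hc))) ?_
        rw [tendsto_map'_iff]
        exact hy'
    obtain ⟨T, hT⟩ := H.exists_isSchemeLimit hp hA fun f hf s =>
      (hcpt f hf s).imp fun _ hy => hy.2
    have hT' := H.isLC0Semigroup_of_isSchemeLimit hp hT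
    refine ⟨T, hT', fun x y => ?_⟩
    rw [hT'.map_zero]
    refine H.mem_iff_tendsto_quotient hp hT hΓ hΓG hA (fun a ha => ⟨hdom a (hAZ ha), fun s => ?_⟩)
      x y
    obtain ⟨y, ⟨z, hyz⟩, hy⟩ := hcpt a ha s
    have hfl := H.tendsto_floor_mul s.2
    exact ⟨z, by rwa [tendsto_nhds_unique (hT s a _ hfl) (hy _ hfl)]⟩
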